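/- **Setting.** Fix $K\ge 2$. For each stage $t\in\mathbb N$ consider a topic model with $n=n_t\to\infty$ documents of $N=N_t\to\infty$ words from a dictionary of $p=p_t$ words. (All objects below may depend on $t$ unless stated otherwise; the index $t$ is suppressed.) The mixture components $A=[A_1,\dots,A_K]\in\mathbb R^{p\times K}$ have columns in the simplex $\Delta_p$, are affinely independent, and no row of $A$ vanishes. Document $\ell\in[n]$ has weights $\alpha^{(\ell)}\in\Delta_K$, $r^{(\ell)}=A\alpha^{(\ell)}$, the counts $Y^{(\ell)}\sim\mathrm{Multinomial}_p(N,r^{(\ell)})$ are independent over $\ell$, and $X^{(\ell)}=Y^{(\ell)}/N$. Let $d$ be a metric on $\Delta_p$ and let $i\neq j$ be two documents such that $\alpha^{(i)}-\alpha^{(j)}$ and the distances $d(A_k,A_l)$, $k,l\in[K]$, do not vary with $t$. Let $W=W(\boldsymbol\alpha^{(i)},\boldsymbol\alpha^{(j)};d)$ be the Wasserstein distance between $\boldsymbol\alpha^{(i)}=\sum_k\alpha^{(i)}_k\delta_{A_k}$ and $\boldsymbol\alpha^{(j)}=\sum_k\alpha^{(j)}_k\delta_{A_k}$, and put $$\mathcal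 F=\{f\in\mathbb R^K: f_k-f_l\le d(A_k,A_l)\ \forall k,l,\ f_1=0\},\qquad \mathcal F'_{ij}=\mathcal F\cap\{f: f^\top(\alpha^{(i)}-\alpha^{(j)})=W\}.$$ (These, and $W$, then do not vary with $t$.) For a $p\times K$ matrix $B$ with nonnegative entries let $D_B=\mathrm{diag}(\|B_{1\cdot}\|_1,\dots,\|B_{p\cdot}\|_1)$ and $B^+=(B^\top D_B^{-1}B)^{-1}B^\top D_B^{-1}$. Write $D=D_A$, $M=A^\top D^{-1}A$ and, for $\ell\in\{i,j\}$, $$V^{(\ell)}_{LS}=A^\top D^{-1}\bigl(\mathrm{diag}(r^{(\ell)})-r^{(\ell)}r^{(\ell)\top}\bigr)D^{-1}A,\qquad \Sigma^{(\ell)}_{LS}=M^{-1}V^{(\ell)}_{LS}M^{-1}.$$ Let $\lambda_m(\cdot)$ denote the $m$-th largest eigenvalue of a symmetric matrix. One always has $V^{(\ell)}_{LS}\mathbf 1_K=0$, so $\lambda_K(V^{(\ell)}_{LS})=0$; put $\lambda=\lambda_{K-1}(V^{(i)}_{LS})\wedge\lambda_{K-1}(V^{(j)}_{LS})$. Let $\widehat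 A$ be any random matrix with columns in $\Delta_p$, defined on the same probability space as the data and possibly dependent on them, such that for deterministic sequences $\epsilon_A,\epsilon_{1,\infty},\epsilon_{\infty,1}$ and, after a (possibly random) relabelling of the columns of $\widehat A$, $$\mathbb E\Bigl[\max_{k}d(\widehat A_k,A_k)\Bigr]\le\epsilon_A,$$ and, with probability tending to one, $$\max_k\|\widehat A_k-A_k\|_1\le\epsilon_{1,\infty},\qquad \max_{m\in[p]}\frac{\|\widehat A_{m\cdot}-A_{m\cdot}\|_1}{\|A_{m\cdot}\|_1}\le\epsilon_{\infty,1}.$$ Define $\widetilde\alpha^{(\ell)}_{LS}=\widehat A^+X^{(\ell)}$ for $\ell\in\{i,j\}$ and $$\widetilde W_{LS}=\sup_{f\in\widehat{\mathcal F}}f^\top\bigl(\widetilde\alpha^{(i)}_{LS}-\widetilde\alpha^{(j)}_{LS}\bigr),\qquad \widehat{\mathcal F}=\{f\in\mathbb R^K: f_k-f_l\le d(\widehat A_k,\widehat A_l)\ \forall k,l,\ f_1=0\}.$$ **Theorem.** Assume that, as $t\to\infty$, $\lambda_K^{-1}(M)=O(\sqrt N)$, $\epsilon_A\sqrt N\to0$,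 $\lambda>0$ eventually with $\lambda^{-1}=o(N)$, and $$(\epsilon_{1,\infty}+\epsilon_{\infty,1})\sqrt{N/\lambda}\to0,$$ and that $Q=\lim_{t\to\infty}\bigl(\Sigma^{(i)}_{LS}+\Sigma^{(j)}_{LS}\bigr)$ exists. Let $G_{ij}\sim\mathcal N_K(0,Q)$. Then $$\sqrt N\,\bigl(\widetilde W_{LS}-W(\boldsymbol\alpha^{(i)},\boldsymbol\alpha^{(j)};d)\bigr)\ \overset{d}{\longrightarrow}\ \sup_{f\in\mathcal F'_{ij}}f^\top G_{ij}\qquad\text{as }t\to\infty.$$ -/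

import Mathlib

open Filter Topology MeasureTheory ProbabilityTheory
open scoped Matrix Asymptotics

noncomputable section

namespace TopicLS

/-! ### Metrics on the simplex, Wasserstein distance, dual polytopes -/

/-- `d` is a metric on the type `X` (no relation to any topology `X` may carry is required). -/
structure IsMetric {X : Type*} (d : X → X → ℝ) : Prop where
  self : ∀ x, d x x = 0
  eq_of : ∀ x y, d x y = 0 → x = y
  symm : ∀ x y, d x y = d y x
  triangle : ∀ x y z, d x z ≤ d x y + d y z

/-- The matrix of pairwise distances `d (A k) (A l)` of a finite family of points. -/
def cost {X : Type*} {K : ℕ} (d : X → X → ℝ) (A : Fin K → X) : Matrix (Fin K) (Fin K) ℝ :=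
  Matrix.of fun k l => d (A k) (A l)

/-- Couplings of the discrete measures `∑ k, a k δ_{x k}` and `∑ k, b k δ_{x k}` carried by the
same distinct points `x k`, identified with nonnegative matrices with marginals `a` and `b`. -/
def couplings {K : ℕ} (a b : Fin K → ℝ) : Set (Matrix (Fin K) (Fin K) ℝ) :=
  {γ | (∀ k l, 0 ≤ γ k l) ∧ (∀ k, ∑ l, γ k l = a k) ∧ (∀ l, ∑ k, γ k l = b l)}

/-- The Wasserstein distance of `∑ k, a k δ_{x k}` and `∑ k, b k δ_{x k}`, where `c k l` is the
distance between `x k` and `x l`: the least cost of a coupling. -/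
def wasserstein {K : ℕ} (c : Matrix (Fin K) (Fin K) ℝ) (a b : Fin K → ℝ) : ℝ :=
  sInf ((fun γ : Matrix (Fin K) (Fin K) ℝ => ∑ k, ∑ l, γ k l * c k l) '' couplings a b)

/-- The dual polytope `{f | f k - f l ≤ c k l, f 1 = 0}` (the first index is `0 : Fin K`). -/
def dualPolytope {K : ℕ} [NeZero K] (c : Matrix (Fin K) (Fin K) ℝ) : Set (Fin K → ℝ) :=
  {f | (∀ k l, f k - f l ≤ c k l) ∧ f 0 = 0}

/-- The face of the dual polytope on which `f ⬝ᵥ u` takes the value `w`. -/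
def dualFace {K : ℕ} [NeZero K] (c : Matrix (Fin K) (Fin K) ℝ) (u : Fin K → ℝ) (w : ℝ) :
    Set (Fin K → ℝ) :=
  dualPolytope c ∩ {f | f ⬝ᵥ u = w}

/-- `sup_{f ∈ S} fᵀ x`. -/
def supportFun {K : ℕ} (S : Set (Fin K → ℝ)) (x : Fin K → ℝ) : ℝ :=
  sSup ((fun f => f ⬝ᵥ x) '' S)

/-! ### Multinomial sampling -/

/-- The distribution on `Fin p` with point masses `r j`. -/
def categorical {p : ℕ} (r : Fin p → ℝ) : Measure (Fin p) :=
  ∑ j, ENNReal.ofReal (r j) • Measure.dirac j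

/-- `Multinomial_p (N, r)`: the law of the vector of counts of `N` independent draws from `r`. -/
def multinomial {p : ℕ} (N : ℕ) (r : Fin p → ℝ) : Measure (Fin p → ℕ) :=
  (Measure.pi fun _ : Fin N => categorical r).map
    fun z j => (Finset.univ.filter fun s => z s = j).card

/-- Observed frequencies `Y / N`. -/
def freq {p : ℕ} (N : ℕ) (Y : Fin p → ℕ) : Fin p → ℝ := fun j => (Y j : ℝ) / N

/-! ### Weighted least squares -/

/-- The `p × K` matrix whose columns are the given probability vectors. -/
def colMatrix {p K : ℕ} (A : Fin K → stdSimplex ℝ (Fin p)) : Matrix (Fin p) (Fin K) ℝ :=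
  Matrix.of fun j k => (A k : Fin p → ℝ) j

/-- `D⁻¹` for `D = diag (‖B_{1·}‖₁, …, ‖B_{p·}‖₁)`. -/
def rowDiagInv {p K : ℕ} (B : Matrix (Fin p) (Fin K) ℝ) : Matrix (Fin p) (Fin p) ℝ :=
  Matrix.diagonal fun j => (∑ k, |B j k|)⁻¹

/-- `M = Bᵀ D⁻¹ B`. -/
def gram {p K : ℕ} (B : Matrix (Fin p) (Fin K) ℝ) : Matrix (Fin K) (Fin K) ℝ :=
  Bᵀ * rowDiagInv B * B

/-- `B⁺ = (Bᵀ D⁻¹ B)⁻¹ Bᵀ D⁻¹`. -/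
def lsInv {p K : ℕ} (B : Matrix (Fin p) (Fin K) ℝ) : Matrix (Fin K) (Fin p) ℝ :=
  (gram B)⁻¹ * Bᵀ * rowDiagInv B

/-- `V_LS = Aᵀ D⁻¹ (diag r - r rᵀ) D⁻¹ A`. -/
def vLS {p K : ℕ} (B : Matrix (Fin p) (Fin K) ℝ) (r : Fin p → ℝ) : Matrix (Fin K) (Fin K) ℝ :=
  Bᵀ * rowDiagInv B * (Matrix.diagonal r - Matrix.vecMulVec r r) * rowDiagInv B * B

/-- `Σ_LS = M⁻¹ V_LS M⁻¹`. -/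
def sigmaLS {p K : ℕ} (B : Matrix (Fin p) (Fin K) ℝ) (r : Fin p → ℝ) :
    Matrix (Fin K) (Fin K) ℝ :=
  (gram B)⁻¹ * vLS B r * (gram B)⁻¹

/-- The `m`-th largest eigenvalue `λ_m(S)`, `1 ≤ m ≤ K`, of a symmetric `K × K` matrix `S`,
counted with multiplicity. -/
def eig {K : ℕ} (m : ℕ) (S : Matrix (Fin K) (Fin K) ℝ) : ℝ :=
  open scoped Classical in
  if h : S.IsHermitian ∧ m - 1 < Fintype.card (Fin K) then h.1.eigenvalues₀ ⟨m - 1, h.2⟩ else 0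

/-- The distance estimator `sup_{f ∈ F̂} fᵀ (B⁺ x - B⁺ y)`, where `B` is the matrix with columns
`Â k` and `F̂` is the dual polytope of the distances `d (Â k) (Â l)`. -/
def wLS {p K : ℕ} [NeZero K] (d : stdSimplex ℝ (Fin p) → stdSimplex ℝ (Fin p) → ℝ)
    (Ahat : Fin K → stdSimplex ℝ (Fin p)) (x y : Fin p → ℝ) : ℝ :=
  supportFun (dualPolytope (cost d Ahat))
    (lsInv (colMatrix Ahat) *ᵥ x - lsInv (colMatrix Ahat) *ᵥ y)

/-- The columns of the estimator `B`, relabelled by `π`, are within `ε₁` of those of `A` in `ℓ¹`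
norm, and its rows are within relative `ℓ¹` error `ε₂` of those of `A`. -/
def CloseUpTo {p K : ℕ} (π : Equiv.Perm (Fin K)) (B A : Matrix (Fin p) (Fin K) ℝ)
    (ε₁ ε₂ : ℝ) : Prop :=
  (∀ k, ∑ j, |B j (π k) - A j k| ≤ ε₁) ∧
    ∀ j, (∑ k, |B j (π k) - A j k|) / ∑ k, |A j k| ≤ ε₂

end TopicLS

end

namespace TopicLS

/-! ### Support functions -/

/-! Write `h` for the support function of the dual polytope of the true costs and `u` for the
difference of the two weight vectors. Kantorovich duality (`IsPseudo.wasserstein_eq`) gives `W =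
h(u)`, and the estimator is the support function of the estimated polytope at `Â⁺(X⁽ⁱ⁾ - X⁽ʲ⁾)`. The
proof is a delta method for `h`, preceded by two replacements whose errors are negligible even after
multiplication by `√N`.

Replacing the estimated polytope by the true one changes the support function by a multiple of the
cost error: by McShane's extension an almost 1-Lipschitz potential is close to a 1-Lipschitz one
(`IsPseudo.abs_supportFun_sub_le`). The argument must have coordinate sum zero, which holds because
least squares preserves total mass.

Replacing `Â⁺` by `A⁺` costs a multiple of `‖M⁻¹‖ (ε₁ + ε₂)` (`norm_lsInv_sub_le`). The point is
that `‖M⁻¹‖ = O(λ^(-1/2))` (`IsTopic.norm_inv_gram_mulVec_le`): the covariances `M⁻¹ V M⁻¹` stay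
bounded since their sum converges, `V` is at least `λ` on the complement of the all-ones vector, and
`M⁻¹` fixes that vector. Both replacements are combined in `abs_wLS_sub_le`.

What remains is `√N (h(u + Z/√N) - h(u))`, where `Z` is the rescaled error of the infeasible
estimator built from `A`. Since `h` is directionally differentiable at `u`, uniformly over bounded
directions, with derivative the support function of the exposed face
(`eventually_supportFun_slope`), this is close to that support function at `Z`. Finally `Z` is
asymptotically `N(0, Q)` (`tendstoInDistribution_multinomial`): the characteristic function of a
linear statistic of multinomial frequencies is Gaussian up to an error that sees the growing
dimension `p` only through the sup norm of the coefficients, and the bound on `M⁻¹` together with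
`λ⁻¹ = o(N)` makes this error vanish. -/

lemma abs_dotProduct_le {K : ℕ} (f x : Fin K → ℝ) : |f ⬝ᵥ x| ≤ K * ‖f‖ * ‖x‖ := by
  unfold dotProduct
  calc |∑ k, f k * x k| ≤ ∑ k, |f k * x k| := Finset.abs_sum_le_sum_abs _ _
    _ ≤ ∑ _k : Fin K, ‖f‖ * ‖x‖ := by
        refine Finset.sum_le_sum fun k _ => ?_
        rw [abs_mul]
        exact mul_le_mul (norm_le_pi_norm f k) (norm_le_pi_norm x k) (abs_nonneg _) (norm_nonneg _)
    _ = K * ‖f‖ * ‖x‖ := by simp [mul_assoc]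

lemma bddAbove_image_dotProduct {K : ℕ} {S : Set (Fin K → ℝ)} {R : ℝ}
    (hR : ∀ f ∈ S, ‖f‖ ≤ R) (x : Fin K → ℝ) : BddAbove ((fun f => f ⬝ᵥ x) '' S) := by
  refine ⟨K * R * ‖x‖, ?_⟩
  rintro _ ⟨f, hf, rfl⟩
  refine (le_abs_self _).trans ((abs_dotProduct_le f x).trans ?_)
  have := hR f hf
  gcongr

lemma le_supportFun {K : ℕ} {S : Set (Fin K → ℝ)} {R : ℝ} (hR : ∀ f ∈ S, ‖f‖ ≤ R)
    {f : Fin K → ℝ} (hf : f ∈ S) (x : Fin K → ℝ) : f ⬝ᵥ x ≤ supportFun S x :=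
  le_csSup (bddAbove_image_dotProduct hR x) ⟨f, hf, rfl⟩

lemma supportFun_le {K : ℕ} {S : Set (Fin K → ℝ)} (hS : S.Nonempty) {x : Fin K → ℝ} {b : ℝ}
    (h : ∀ f ∈ S, f ⬝ᵥ x ≤ b) : supportFun S x ≤ b := by
  refine csSup_le (hS.image _) ?_
  rintro _ ⟨f, hf, rfl⟩
  exact h f hf

lemma continuous_dotProduct_right {K : ℕ} (x : Fin K → ℝ) : Continuous fun f => f ⬝ᵥ x := by
  unfold dotProduct; fun_prop

lemma exists_supportFun_eq {K : ℕ} {S : Set (Fin K → ℝ)} (hS : S.Nonempty) (hc : IsCompact S)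
    (x : Fin K → ℝ) : ∃ f ∈ S, f ⬝ᵥ x = supportFun S x := by
  obtain ⟨f, hf, hmax⟩ := hc.exists_isMaxOn hS (continuous_dotProduct_right x).continuousOn
  obtain ⟨R, hR⟩ := hc.isBounded.exists_norm_le
  exact ⟨f, hf, le_antisymm (le_supportFun hR hf x) (supportFun_le hS fun g hg => hmax hg)⟩

lemma supportFun_sub_le {K : ℕ} {S : Set (Fin K → ℝ)} (hS : S.Nonempty) {R : ℝ}
    (hR : ∀ f ∈ S, ‖f‖ ≤ R) (x y : Fin K → ℝ) :
    supportFun S x - supportFun S y ≤ K * R * ‖x - y‖ := by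
  rw [sub_le_iff_le_add]
  refine supportFun_le hS fun f hf => ?_
  have h1 := le_supportFun hR hf y
  have h2 := (le_abs_self _).trans (abs_dotProduct_le f (x - y))
  have h3 : K * ‖f‖ * ‖x - y‖ ≤ K * R * ‖x - y‖ := by have := hR f hf; gcongr
  rw [dotProduct_sub] at h2
  linarith

lemma abs_supportFun_sub_le {K : ℕ} {S : Set (Fin K → ℝ)} (hS : S.Nonempty) {R : ℝ}
    (hR : ∀ f ∈ S, ‖f‖ ≤ R) (x y : Fin K → ℝ) :
    |supportFun S x - supportFun S y| ≤ K * R * ‖x - y‖ := by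
  refine abs_le.2 ⟨?_, supportFun_sub_le hS hR x y⟩
  have := supportFun_sub_le hS hR y x
  rw [norm_sub_rev] at this
  linarith

lemma continuous_supportFun {K : ℕ} {S : Set (Fin K → ℝ)} (hS : S.Nonempty) {R : ℝ}
    (hR : ∀ f ∈ S, ‖f‖ ≤ R) : Continuous (supportFun S) := by
  have hR0 : 0 ≤ R := (norm_nonneg _).trans (hR _ hS.some_mem)
  refine (LipschitzWith.of_dist_le_mul (K := ⟨K * R, by positivity⟩) fun x y => ?_).continuous
  rw [Real.dist_eq, dist_eq_norm]
  exact abs_supportFun_sub_le hS hR x y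

/-- The support function of a compact set is directionally differentiable, uniformly on bounded
sets of directions; the derivative is the support function of the exposed face. -/
lemma eventually_supportFun_slope {K : ℕ} {S : Set (Fin K → ℝ)} (hS : S.Nonempty)
    (hc : IsCompact S) (u : Fin K → ℝ) (R : ℝ) {ε : ℝ} (hε : 0 < ε) :
    ∀ᶠ s : ℝ in atTop, ∀ z : Fin K → ℝ, ‖z‖ ≤ R →
      |s * (supportFun S (u + s⁻¹ • z) - supportFun S u)
        - supportFun (S ∩ {f | f ⬝ᵥ u = supportFun S u}) z| ≤ ε := by
  obtain ⟨B, hB⟩ := hc.isBounded.exists_norm_le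
  have hB0 : 0 ≤ B := (norm_nonneg _).trans (hB _ hS.some_mem)
  obtain ⟨f₀, hf₀, hf₀u⟩ := exists_supportFun_eq hS hc u
  set w := supportFun S u with hw
  set T := S ∩ {f | f ⬝ᵥ u = w} with hT
  have hTne : T.Nonempty := ⟨f₀, hf₀, hf₀u⟩
  have hTB : ∀ f ∈ T, ‖f‖ ≤ B := fun f hf => hB f hf.1
  have hbound : ∀ f ∈ S, ∀ z : Fin K → ℝ, ‖z‖ ≤ R → |f ⬝ᵥ z| ≤ K * B * |R| := fun f hf z hz => by
    refine (abs_dotProduct_le f z).trans ?_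
    have h1 := hB f hf
    have h2 := hz.trans (le_abs_self R)
    gcongr
  -- Chosen so that moving a potential by `ρ` changes its product with any `z` of norm at most `R`
  -- by at most `ε`.
  set ρ : ℝ := ε / (K * |R| + 1) with hρ
  have hρ0 : 0 < ρ := by positivity
  -- Compactness: the potentials at distance at least `ρ` from the face form a compact set, on which
  -- the maximum of `f ⬝ᵥ u` stays strictly below `w`. Half of that gap serves as `δ`.
  have hnear : ∃ δ > 0, ∀ f ∈ S, w - δ ≤ f ⬝ᵥ u → ∃ g ∈ T, ‖f - g‖ < ρ := by
    set S' := S ∩ {f | ρ ≤ Metric.infDist f T}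
    have hS'c : IsCompact S' := hc.inter_right
      (isClosed_le continuous_const (Metric.continuous_infDist_pt T))
    have key : ∀ f ∈ S, f ∉ S' → ∃ g ∈ T, ‖f - g‖ < ρ := fun f hf hf' => by
      have : Metric.infDist f T < ρ := by
        by_contra h
        exact hf' ⟨hf, not_lt.1 h⟩
      obtain ⟨g, hg, hfg⟩ := (Metric.infDist_lt_iff hTne).1 this
      exact ⟨g, hg, by rwa [← dist_eq_norm]⟩
    rcases S'.eq_empty_or_nonempty with h | h
    · exact ⟨1, one_pos, fun f hf _ => key f hf (by simp [h])⟩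
    · obtain ⟨f₁, hf₁, hmax⟩ := hS'c.exists_isMaxOn h (continuous_dotProduct_right u).continuousOn
      have hlt : f₁ ⬝ᵥ u < w := by
        refine lt_of_le_of_ne (le_supportFun hB hf₁.1 u) fun he => ?_
        have h0 : Metric.infDist f₁ T = 0 := Metric.infDist_zero_of_mem ⟨hf₁.1, he⟩
        have := hf₁.2
        rw [Set.mem_ofPred_eq, h0] at this
        linarith
      refine ⟨(w - f₁ ⬝ᵥ u) / 2, by linarith, fun f hf hfu => key f hf fun hf' => ?_⟩
      have : f ⬝ᵥ u ≤ f₁ ⬝ᵥ u := hmax hf'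
      linarith
  obtain ⟨δ, hδ, hnear⟩ := hnear
  filter_upwards [eventually_gt_atTop 0, eventually_ge_atTop (2 * (K * B * |R|) / δ)]
    with s hs hsδ z hz
  have hexp : ∀ f : Fin K → ℝ, s * (f ⬝ᵥ (u + s⁻¹ • z) - w) = s * (f ⬝ᵥ u - w) + f ⬝ᵥ z := by
    intro f
    rw [dotProduct_add, dotProduct_smul, smul_eq_mul]
    field_simp
    ring
  -- Elements of the face are competitors in the perturbed problem, which gives the lower bound for
  -- every `s > 0`. The upper bound needs a maximiser of the perturbed problem to be close to the
  -- face.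
  have hlow : supportFun T z ≤ s * (supportFun S (u + s⁻¹ • z) - w) := by
    refine supportFun_le hTne fun f hf => ?_
    have h1 := hexp f
    have h2 : f ⬝ᵥ u = w := hf.2
    have h3 := le_supportFun hB hf.1 (u + s⁻¹ • z)
    rw [h2, sub_self, mul_zero, zero_add] at h1
    rw [← h1]
    gcongr
  obtain ⟨f, hf, hfe⟩ := exists_supportFun_eq hS hc (u + s⁻¹ • z)
  rw [← hfe] at hlow ⊢
  rw [hexp] at hlow ⊢
  have hT0 : -(K * B * |R|) ≤ supportFun T z :=
    (neg_le_of_abs_le (hbound f₀ hf₀ z hz)).trans (le_supportFun hTB ⟨hf₀, hf₀u⟩ z)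
  have hfz := le_of_abs_le (hbound f hf z hz)
  have hfw : f ⬝ᵥ u ≤ w := le_supportFun hB hf u
  have hδs : 2 * (K * B * |R|) ≤ s * δ := by rwa [div_le_iff₀ hδ] at hsδ
  -- If `f` missed the maximum at `u` by more than `δ`, the loss `s * δ ≥ 2 K B |R|` would exceed
  -- everything that the `z` term can regain, contradicting `hlow`.
  obtain ⟨g, hg, hfg⟩ := hnear f hf (by
    by_contra hcon
    have : s * (f ⬝ᵥ u - w) < s * (-δ) := mul_lt_mul_of_pos_left (by linarith) hs
    linarith)
  have hgz := le_supportFun hTB hg z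
  have hd := (le_abs_self _).trans (abs_dotProduct_le (f - g) z)
  have hd2 : K * ‖f - g‖ * ‖z‖ ≤ ε := by
    calc K * ‖f - g‖ * ‖z‖ ≤ K * ρ * |R| := by
          have := hz.trans (le_abs_self R)
          gcongr
      _ = ε * ((K * |R|) / (K * |R| + 1)) := by rw [hρ]; ring
      _ ≤ ε * 1 := by
          gcongr
          rw [div_le_one (by positivity)]
          linarith
      _ = ε := mul_one _
  rw [sub_dotProduct] at hd
  have hneg : s * (f ⬝ᵥ u - w) ≤ 0 := mul_nonpos_of_nonneg_of_nonpos hs.le (by linarith)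
  rw [abs_le]
  constructor <;> linarith

/-! ### Dual polytopes -/

/-- A pseudometric on `Fin K`, as a matrix. -/
structure IsPseudo {K : ℕ} (c : Matrix (Fin K) (Fin K) ℝ) : Prop where
  self : ∀ k, c k k = 0
  symm : ∀ k l, c k l = c l k
  triangle : ∀ k l m, c k m ≤ c k l + c l m

lemma IsPseudo.nonneg {K : ℕ} {c : Matrix (Fin K) (Fin K) ℝ} (hc : IsPseudo c) (k l : Fin K) :
    0 ≤ c k l := by
  have := hc.triangle k l k
  rw [hc.self, hc.symm l k] at this
  linarith

lemma IsMetric.isPseudo_cost {X : Type*} {d : X → X → ℝ} (hd : IsMetric d) {K : ℕ}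
    (A : Fin K → X) : IsPseudo (cost d A) :=
  ⟨fun _ => hd.self _, fun _ _ => hd.symm _ _, fun _ _ _ => hd.triangle _ _ _⟩

lemma exists_entries_le {K : ℕ} (c : Matrix (Fin K) (Fin K) ℝ) : ∃ R, 0 ≤ R ∧ ∀ k l, c k l ≤ R := by
  refine ⟨∑ k, ∑ l, |c k l|, by positivity, fun k l => (le_abs_self _).trans ?_⟩
  refine (Finset.single_le_sum (f := fun l => |c k l|) (fun _ _ => abs_nonneg _)
    (Finset.mem_univ l)).trans ?_
  exact Finset.single_le_sum (f := fun k => ∑ l, |c k l|)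
    (fun _ _ => Finset.sum_nonneg fun _ _ => abs_nonneg _) (Finset.mem_univ k)

variable {K : ℕ} [NeZero K]

lemma IsPseudo.zero_mem {c : Matrix (Fin K) (Fin K) ℝ} (hc : IsPseudo c) :
    (0 : Fin K → ℝ) ∈ dualPolytope c :=
  ⟨fun k l => by simpa using hc.nonneg k l, rfl⟩

lemma IsPseudo.nonempty {c : Matrix (Fin K) (Fin K) ℝ} (hc : IsPseudo c) :
    (dualPolytope c).Nonempty := ⟨0, hc.zero_mem⟩

lemma IsPseudo.norm_le_of_mem {c : Matrix (Fin K) (Fin K) ℝ} (hc : IsPseudo c) {R : ℝ}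
    (hR : ∀ k l, c k l ≤ R) {f : Fin K → ℝ} (hf : f ∈ dualPolytope c) : ‖f‖ ≤ R := by
  refine (pi_norm_le_iff_of_nonneg ((hc.nonneg 0 0).trans (hR 0 0))).2 fun k => ?_
  have h1 := hf.1 k 0
  have h2 := hf.1 0 k
  rw [hf.2] at h1 h2
  rw [Real.norm_eq_abs, abs_le]
  constructor <;> linarith [hR k 0, hR 0 k]

lemma isClosed_dualPolytope (c : Matrix (Fin K) (Fin K) ℝ) : IsClosed (dualPolytope c) := by
  have : dualPolytope c = (⋂ k, ⋂ l, {f | f k - f l ≤ c k l}) ∩ {f | f 0 = 0} := by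
    ext f; simp [dualPolytope]
  rw [this]
  refine IsClosed.inter (isClosed_iInter fun k => isClosed_iInter fun l => ?_) ?_
  · exact isClosed_le (by fun_prop) continuous_const
  · exact isClosed_eq (by fun_prop) continuous_const

lemma IsPseudo.isCompact {c : Matrix (Fin K) (Fin K) ℝ} (hc : IsPseudo c) :
    IsCompact (dualPolytope c) := by
  obtain ⟨R, -, hR⟩ := exists_entries_le c
  exact (isCompact_closedBall (0 : Fin K → ℝ) R).of_isClosed_subset (isClosed_dualPolytope c)
    fun f hf => mem_closedBall_zero_iff.2 (hc.norm_le_of_mem hR hf)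

/-- McShane's construction: a function that is almost `1`-Lipschitz for `c` is close to a
`1`-Lipschitz function. -/
lemma IsPseudo.exists_lipschitz {c : Matrix (Fin K) (Fin K) ℝ} (hc : IsPseudo c) {δ : ℝ}
    {f : Fin K → ℝ} (hf : ∀ k l, f k - f l ≤ c k l + δ) :
    ∃ g : Fin K → ℝ, (∀ k l, g k - g l ≤ c k l) ∧ ∀ k, f k - δ ≤ g k ∧ g k ≤ f k := by
  have hne : (Finset.univ : Finset (Fin K)).Nonempty := Finset.univ_nonempty
  refine ⟨fun k => Finset.univ.inf' hne fun l => f l + c k l, fun k l => ?_, fun k => ⟨?_, ?_⟩⟩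
  · obtain ⟨m, -, hm⟩ := Finset.exists_mem_eq_inf' hne fun m => f m + c l m
    have h1 : (Finset.univ.inf' hne fun m => f m + c k m) ≤ f m + c k m :=
      Finset.inf'_le _ (Finset.mem_univ m)
    have h2 := hc.triangle k l m
    simp only [hm]
    linarith
  · refine Finset.le_inf' _ _ fun l _ => ?_
    have := hf k l
    linarith
  · refine (Finset.inf'_le _ (Finset.mem_univ k)).trans ?_
    simp [hc.self]

/-- Against a vector of coordinate sum zero, adding a constant to a potential changes nothing, so
the normalisation `f 0 = 0` can be dropped. -/
lemma IsPseudo.dotProduct_le_supportFun {c : Matrix (Fin K) (Fin K) ℝ} (hc : IsPseudo c)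
    {x : Fin K → ℝ} (hx : ∑ k, x k = 0) {g : Fin K → ℝ} (hg : ∀ k l, g k - g l ≤ c k l) :
    g ⬝ᵥ x ≤ supportFun (dualPolytope c) x := by
  obtain ⟨R, -, hR⟩ := exists_entries_le c
  have hmem : (fun k => g k - g 0) ∈ dualPolytope c :=
    ⟨fun k l => by simpa using hg k l, sub_self _⟩
  have := le_supportFun (fun f hf => hc.norm_le_of_mem hR hf) hmem x
  refine le_of_eq_of_le ?_ this
  simp [dotProduct, sub_mul, ← Finset.mul_sum, hx]

/-- A potential admissible for `c'` violates the constraints of `c` by at most `δ`, so McShane's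
construction moves it by at most `δ` in sup norm to one admissible for `c`. No lower bound on the
costs enters. -/
lemma IsPseudo.supportFun_sub_le_of_le {c c' : Matrix (Fin K) (Fin K) ℝ} (hc : IsPseudo c)
    (hc' : IsPseudo c') {δ : ℝ} (h : ∀ k l, c' k l ≤ c k l + δ) {x : Fin K → ℝ}
    (hx : ∑ k, x k = 0) :
    supportFun (dualPolytope c') x - supportFun (dualPolytope c) x ≤ K * δ * ‖x‖ := by
  have hδ : 0 ≤ δ := by have := h 0 0; rw [hc.self, hc'.self] at this; linarith
  rw [sub_le_iff_le_add]
  refine supportFun_le hc'.nonempty fun f hf => ?_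
  obtain ⟨g, hg, hfg⟩ := hc.exists_lipschitz (δ := δ) fun k l => (hf.1 k l).trans (h k l)
  have h1 := hc.dotProduct_le_supportFun hx hg
  have h2 := (le_abs_self _).trans (abs_dotProduct_le (f - g) x)
  have h3 : ‖f - g‖ ≤ δ := by
    refine (pi_norm_le_iff_of_nonneg hδ).2 fun k => ?_
    rw [Real.norm_eq_abs, Pi.sub_apply, abs_le]
    have := hfg k
    constructor <;> linarith
  have h4 : K * ‖f - g‖ * ‖x‖ ≤ K * δ * ‖x‖ := by gcongr
  rw [sub_dotProduct] at h2
  linarith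

lemma IsPseudo.abs_supportFun_sub_le {c c' : Matrix (Fin K) (Fin K) ℝ} (hc : IsPseudo c)
    (hc' : IsPseudo c') {δ : ℝ} (h : ∀ k l, |c' k l - c k l| ≤ δ) {x : Fin K → ℝ}
    (hx : ∑ k, x k = 0) :
    |supportFun (dualPolytope c') x - supportFun (dualPolytope c) x| ≤ K * δ * ‖x‖ := by
  have h1 := hc.supportFun_sub_le_of_le hc' (δ := δ)
    (fun k l => by have := abs_le.1 (h k l); linarith) hx
  have h2 := hc'.supportFun_sub_le_of_le hc (δ := δ)
    (fun k l => by have := abs_le.1 (h k l); linarith) hx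
  rw [abs_le]
  constructor <;> linarith

/-- The normalisation singles out the label `0` and is not invariant under relabelling; the zero
coordinate sum makes it immaterial. This is what lets the unknown permutation of the estimated
columns drop out. -/
lemma supportFun_dualPolytope_submatrix (c : Matrix (Fin K) (Fin K) ℝ) (hc : IsPseudo c)
    (τ : Equiv.Perm (Fin K)) {x : Fin K → ℝ} (hx : ∑ k, x k = 0) :
    supportFun (dualPolytope (c.submatrix τ τ)) (x ∘ τ) = supportFun (dualPolytope c) x := by
  have hcτ : IsPseudo (c.submatrix τ τ) :=
    ⟨fun _ => hc.self _, fun _ _ => hc.symm _ _, fun _ _ _ => hc.triangle _ _ _⟩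
  have hxτ : ∑ k, (x ∘ τ) k = 0 := by
    rw [← hx]; exact Equiv.sum_comp τ x
  apply le_antisymm
  · refine supportFun_le hcτ.nonempty fun f hf => ?_
    have := hc.dotProduct_le_supportFun hx (g := f ∘ τ.symm) fun k l => by
      simpa using hf.1 (τ.symm k) (τ.symm l)
    rwa [comp_equiv_symm_dotProduct] at this
  · refine supportFun_le hc.nonempty fun f hf => ?_
    have := hcτ.dotProduct_le_supportFun hxτ (g := f ∘ τ) fun k l => hf.1 (τ k) (τ l)
    rwa [comp_equiv_dotProduct_comp_equiv] at this

/-! ### Kantorovich duality -/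

omit [NeZero K] in
-- The hard half of duality, by Hahn–Banach: the marginals and the cost of all probability matrices
-- form a compact convex set, which misses the closed convex set of triples `(a, b, t)` with `t ≤
-- s`. The coefficients of a separating functional are the potentials, up to scaling and a shift.
lemma exists_potentials {c : Matrix (Fin K) (Fin K) ℝ} {a b : Fin K → ℝ}
    (ha : a ∈ stdSimplex ℝ (Fin K)) (hb : b ∈ stdSimplex ℝ (Fin K)) {s : ℝ}
    (hs : ∀ γ ∈ couplings a b, s < ∑ k, ∑ l, γ k l * c k l) :
    ∃ φ ψ : Fin K → ℝ, (∀ k l, φ k + ψ l ≤ c k l) ∧ s ≤ φ ⬝ᵥ a + ψ ⬝ᵥ b := by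
  let L : (Fin K × Fin K → ℝ) →ₗ[ℝ] (Fin K → ℝ) × (Fin K → ℝ) × ℝ :=
    { toFun := fun γ => (fun k => ∑ l, γ (k, l), fun l => ∑ k, γ (k, l),
        ∑ k, ∑ l, γ (k, l) * c k l)
      map_add' := fun γ γ' => by
        ext <;> simp [Finset.sum_add_distrib, add_mul]
      map_smul' := fun r γ => by
        ext <;> simp [Finset.mul_sum, mul_assoc] }
  have hLc : Continuous L := L.continuous_of_finiteDimensional
  have hcomp : IsCompact (L '' stdSimplex ℝ (Fin K × Fin K)) :=
    (isCompact_stdSimplex (𝕜 := ℝ) (Fin K × Fin K)).image hLc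
  have hconv : Convex ℝ (L '' stdSimplex ℝ (Fin K × Fin K)) :=
    (convex_stdSimplex ℝ (Fin K × Fin K)).linear_image L
  let C₂ : Set ((Fin K → ℝ) × (Fin K → ℝ) × ℝ) := {a} ×ˢ {b} ×ˢ Set.Iic s
  have hC₂ : Convex ℝ C₂ := (convex_singleton a).prod ((convex_singleton b).prod (convex_Iic s))
  have hC₂c : IsClosed C₂ := isClosed_singleton.prod (isClosed_singleton.prod isClosed_Iic)
  have hdisj : Disjoint (L '' stdSimplex ℝ (Fin K × Fin K)) C₂ := by
    rw [Set.disjoint_left]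
    rintro _ ⟨γ, hγ, rfl⟩ ⟨h1, h2, h3⟩
    have h1' : (fun k => ∑ l, γ (k, l)) = a := h1
    have h2' : (fun l => ∑ k, γ (k, l)) = b := h2
    have h3' : ∑ k, ∑ l, γ (k, l) * c k l ≤ s := h3
    have := hs (Matrix.of fun k l => γ (k, l))
      ⟨fun k l => hγ.1 _, fun k => congrFun h1' k, fun l => congrFun h2' l⟩
    simp only [Matrix.of_apply] at this
    linarith
  obtain ⟨F, v₁, v₂, hF1, hv, hF2⟩ :=
    geometric_hahn_banach_compact_closed hconv hcomp hC₂ hC₂c hdisj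
  set φ : Fin K → ℝ := fun k => F (Pi.single k 1, 0, 0)
  set ψ : Fin K → ℝ := fun l => F (0, Pi.single l 1, 0)
  set τ : ℝ := F (0, 0, 1)
  have hsingle : ∀ k : Fin K, (fun j => if k = j then (1 : ℝ) else 0) = Pi.single k 1 := fun k => by
    ext j
    simp [Pi.single_apply, eq_comm]
  have hFe : ∀ x y t, F (x, y, t) = φ ⬝ᵥ x + ψ ⬝ᵥ y + τ * t := by
    intro x y t
    have hx : F (x, 0, 0) = φ ⬝ᵥ x := by
      have := (F.toLinearMap ∘ₗ LinearMap.inl ℝ (Fin K → ℝ) ((Fin K → ℝ) × ℝ)).pi_apply_eq_sum_univ x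
      simp only [LinearMap.comp_apply, LinearMap.inl_apply] at this
      refine (this.trans ?_)
      simp only [dotProduct, smul_eq_mul, φ]
      refine Finset.sum_congr rfl fun k _ => ?_
      rw [mul_comm]
      rw [hsingle]
      rfl
    have hy : F (0, y, 0) = ψ ⬝ᵥ y := by
      have := (F.toLinearMap ∘ₗ LinearMap.inr ℝ (Fin K → ℝ) ((Fin K → ℝ) × ℝ) ∘ₗ
        LinearMap.inl ℝ (Fin K → ℝ) ℝ).pi_apply_eq_sum_univ y
      simp only [LinearMap.comp_apply, LinearMap.inl_apply, LinearMap.inr_apply] at this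
      refine (this.trans ?_)
      simp only [dotProduct, smul_eq_mul, ψ]
      refine Finset.sum_congr rfl fun k _ => ?_
      rw [mul_comm]
      rw [hsingle]
      rfl
    have ht : F (0, 0, t) = τ * t := by
      have : ((0, 0, t) : (Fin K → ℝ) × (Fin K → ℝ) × ℝ) = t • (0, 0, 1) := by simp
      rw [this, map_smul, smul_eq_mul, mul_comm]
    rw [← hx, ← hy, ← ht, ← map_add, ← map_add]
    simp
  have hdom : ∀ γ ∈ stdSimplex ℝ (Fin K × Fin K), ∀ t ≤ s,
      φ ⬝ᵥ (fun k => ∑ l, γ (k, l)) + ψ ⬝ᵥ (fun l => ∑ k, γ (k, l))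
        + τ * ∑ k, ∑ l, γ (k, l) * c k l < φ ⬝ᵥ a + ψ ⬝ᵥ b + τ * t := by
    intro γ hγ t ht
    have h1 := hF1 _ ⟨γ, hγ, rfl⟩
    have h2 := hF2 (a, b, t) ⟨rfl, rfl, ht⟩
    rw [hFe] at h2
    have h1' : F (L γ) = _ := hFe _ _ _
    rw [h1'] at h1
    linarith
  have hprod : (fun x : Fin K × Fin K => a x.1 * b x.2) ∈ stdSimplex ℝ (Fin K × Fin K) := by
    refine ⟨fun x => mul_nonneg (ha.1 _) (hb.1 _), ?_⟩
    rw [Fintype.sum_prod_type]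
    simp [← Finset.mul_sum, hb.2, ha.2]
  -- The independent coupling already has marginals `a` and `b`, so only the cost coordinate can
  -- separate its image from `(a, b, t)`. This excludes a nonnegative coefficient `τ`.
  have hτ : τ < 0 := by
    have h := fun t ht => hdom _ hprod t ht
    simp only [← Finset.mul_sum, ← Finset.sum_mul, hb.2, ha.2, mul_one, one_mul] at h
    set C := ∑ k, ∑ l, a k * b l * c k l
    have h1 : ∀ t ≤ s, τ * C < τ * t := fun t ht => by have := h t ht; linarith
    by_contra hcon
    have h2 := h1 (min s C) (min_le_left _ _)
    have h3 : τ * min s C ≤ τ * C := mul_le_mul_of_nonneg_left (min_le_right _ _) (not_lt.1 hcon)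
    linarith
  set σ := -τ with hσ
  have hσ0 : 0 < σ := by linarith
  -- Separation applied to the point mass at `(k, l)` turns into a pointwise constraint on the
  -- potentials.
  have hkl : ∀ k l, φ k + ψ l - σ * c k l ≤ φ ⬝ᵥ a + ψ ⬝ᵥ b - σ * s := by
    intro k l
    have hmem := single_mem_stdSimplex ℝ (k, l)
    have h := (hdom _ hmem s le_rfl).le
    have e1 : (fun k' => ∑ l', (Pi.single (k, l) 1 : Fin K × Fin K → ℝ) (k', l'))
        = Pi.single k 1 := by
      ext k'
      by_cases hk : k' = k <;> simp [Pi.single_apply, hk]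
    have e2 : (fun l' => ∑ k', (Pi.single (k, l) 1 : Fin K × Fin K → ℝ) (k', l'))
        = Pi.single l 1 := by
      ext l'
      by_cases hl : l' = l <;> simp [Pi.single_apply, hl]
    have e3 : ∑ k', ∑ l', (Pi.single (k, l) 1 : Fin K × Fin K → ℝ) (k', l') * c k' l' = c k l := by
      rw [← Fintype.sum_prod_type' (f := fun k' l' =>
        (Pi.single (k, l) 1 : Fin K × Fin K → ℝ) (k', l') * c k' l')]
      simp [Pi.single_apply]
    rw [e1, e2, e3] at h
    simp only [dotProduct_single_one] at h
    rw [hσ]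
    linarith
  -- Dividing by `σ` normalises the coefficient of the cost to one, and the constant subtracted from
  -- `ψ` makes the constraint `hkl` homogeneous. As `b` has mass one, the dual value becomes exactly
  -- `s`.
  refine ⟨fun k => σ⁻¹ * φ k, fun l => σ⁻¹ * (ψ l - (φ ⬝ᵥ a + ψ ⬝ᵥ b - σ * s)), fun k l => ?_, ?_⟩
  · have := hkl k l
    rw [← mul_add, inv_mul_le_iff₀ hσ0]
    linarith
  · have e1 : (fun k => σ⁻¹ * φ k) ⬝ᵥ a = σ⁻¹ * (φ ⬝ᵥ a) := by
      simp [dotProduct, Finset.mul_sum, mul_assoc]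
    have e2 : (fun l => σ⁻¹ * (ψ l - (φ ⬝ᵥ a + ψ ⬝ᵥ b - σ * s))) ⬝ᵥ b
        = σ⁻¹ * (ψ ⬝ᵥ b - (φ ⬝ᵥ a + ψ ⬝ᵥ b - σ * s)) := by
      simp only [dotProduct, mul_assoc, ← Finset.mul_sum, sub_mul, Finset.sum_sub_distrib, hb.2,
        mul_one]
    rw [e1, e2]
    apply le_of_eq
    field_simp
    ring

/-- Kantorovich duality for finitely supported measures. -/
theorem IsPseudo.wasserstein_eq {c : Matrix (Fin K) (Fin K) ℝ} (hc : IsPseudo c)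
    {a b : Fin K → ℝ} (ha : a ∈ stdSimplex ℝ (Fin K)) (hb : b ∈ stdSimplex ℝ (Fin K)) :
    wasserstein c a b = supportFun (dualPolytope c) (a - b) := by
  have hsum : ∑ k, (a - b) k = 0 := by simp [ha.2, hb.2]
  have hne : (couplings a b).Nonempty := by
    refine ⟨Matrix.of fun k l => a k * b l, fun k l => mul_nonneg (ha.1 k) (hb.1 l), ?_, ?_⟩
    · simp [← Finset.mul_sum, hb.2]
    · simp [← Finset.sum_mul, ha.2]
  have hbdd : BddBelow ((fun γ : Matrix (Fin K) (Fin K) ℝ => ∑ k, ∑ l, γ k l * c k l) ''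
      couplings a b) := by
    refine ⟨0, ?_⟩
    rintro _ ⟨γ, hγ, rfl⟩
    exact Finset.sum_nonneg fun k _ => Finset.sum_nonneg fun l _ =>
      mul_nonneg (hγ.1 k l) (hc.nonneg k l)
  apply le_antisymm
  · refine le_of_forall_lt fun s hs => ?_
    obtain ⟨s', hss', hs'⟩ := exists_between hs
    refine hss'.trans_le ?_
    obtain ⟨φ, ψ, hφψ, hle⟩ := exists_potentials (c := c) ha hb (s := s') fun γ hγ =>
      hs'.trans_le (csInf_le hbdd ⟨γ, hγ, rfl⟩)
    have hne' : (Finset.univ : Finset (Fin K)).Nonempty := Finset.univ_nonempty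
    -- The `c`-transform of `ψ`: it dominates `φ`, lies below `-ψ` because `c k k = 0`, and is
    -- 1-Lipschitz by the triangle inequality, so one potential replaces the pair without lowering
    -- the dual value.
    set g : Fin K → ℝ := fun k => Finset.univ.inf' hne' fun l => c k l - ψ l with hg
    have hgφ : ∀ k, φ k ≤ g k := fun k =>
      Finset.le_inf' _ _ fun l _ => by have := hφψ k l; linarith
    have hgψ : ∀ k, g k ≤ -ψ k := fun k => by
      refine (Finset.inf'_le _ (Finset.mem_univ k)).trans ?_
      simp [hc.self]
    have hglip : ∀ k l, g k - g l ≤ c k l := fun k l => by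
      obtain ⟨m, -, hm⟩ := Finset.exists_mem_eq_inf' hne' fun m => c l m - ψ m
      have h1 : g k ≤ c k m - ψ m := Finset.inf'_le _ (Finset.mem_univ m)
      have h2 := hc.triangle k l m
      have h3 : g l = c l m - ψ m := hm
      linarith
    have h1 := hc.dotProduct_le_supportFun hsum hglip
    rw [dotProduct_sub] at h1
    have h2 : φ ⬝ᵥ a ≤ g ⬝ᵥ a :=
      Finset.sum_le_sum fun k _ => mul_le_mul_of_nonneg_right (hgφ k) (ha.1 k)
    have h3 : g ⬝ᵥ b ≤ -(ψ ⬝ᵥ b) := by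
      rw [← neg_dotProduct]
      exact Finset.sum_le_sum fun k _ => mul_le_mul_of_nonneg_right (hgψ k) (hb.1 k)
    linarith
  · refine supportFun_le hc.nonempty fun f hf => le_csInf (hne.image _) ?_
    rintro _ ⟨γ, hγ, rfl⟩
    have e1 : f ⬝ᵥ a = ∑ k, ∑ l, γ k l * f k := by
      simp only [dotProduct, ← Finset.sum_mul, hγ.2.1]
      exact Finset.sum_congr rfl fun _ _ => mul_comm _ _
    have e2 : f ⬝ᵥ b = ∑ k, ∑ l, γ k l * f l := by
      rw [Finset.sum_comm]
      simp only [dotProduct, ← Finset.sum_mul, hγ.2.2]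
      exact Finset.sum_congr rfl fun _ _ => mul_comm _ _
    rw [dotProduct_sub, e1, e2, ← Finset.sum_sub_distrib]
    refine Finset.sum_le_sum fun k _ => ?_
    rw [← Finset.sum_sub_distrib]
    refine Finset.sum_le_sum fun l _ => ?_
    rw [← mul_sub]
    exact mul_le_mul_of_nonneg_left (hf.1 k l) (hγ.1 k l)

end TopicLS

namespace TopicLS

/-! ### Eigenvalues -/

lemma mulVec_apply_eq_sum {m n : ℕ} (M : Matrix (Fin m) (Fin n) ℝ) (x : Fin n → ℝ) (j : Fin m) :
    (M *ᵥ x) j = ∑ k, M j k * x k := rfl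

lemma IsHermitian.dotProduct_mulVec_eigenvectorBasis {K : ℕ} {S : Matrix (Fin K) (Fin K) ℝ}
    (hS : S.IsHermitian) (i : Fin K) (x : Fin K → ℝ) :
    (hS.eigenvectorBasis i).ofLp ⬝ᵥ S *ᵥ x
      = hS.eigenvalues i * ((hS.eigenvectorBasis i).ofLp ⬝ᵥ x) := by
  have hT : Sᵀ = S := by simpa using hS.eq
  rw [Matrix.dotProduct_mulVec, ← Matrix.mulVec_transpose, hT, hS.mulVec_eigenvectorBasis,
    smul_dotProduct, smul_eq_mul]

lemma IsHermitian.sum_eigenvectorBasis_mul {K : ℕ} {S : Matrix (Fin K) (Fin K) ℝ}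
    (hS : S.IsHermitian) (x y : Fin K → ℝ) :
    ∑ i, ((hS.eigenvectorBasis i).ofLp ⬝ᵥ x) * ((hS.eigenvectorBasis i).ofLp ⬝ᵥ y) = x ⬝ᵥ y := by
  have := hS.eigenvectorBasis.sum_inner_mul_inner (WithLp.toLp 2 x) (WithLp.toLp 2 y)
  simp only [EuclideanSpace.inner_eq_star_dotProduct, star_trivial] at this
  rw [dotProduct_comm x y, ← this]
  refine Finset.sum_congr rfl fun i _ => ?_
  rw [dotProduct_comm y]

/-- If `S 1 = 0` and the last but one eigenvalue is positive, it bounds the quadratic form of `S`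
from below on the orthogonal complement of `1`. -/
lemma eig_mul_le {K : ℕ} (hK : 2 ≤ K) {S : Matrix (Fin K) (Fin K) ℝ} (hS : S.IsHermitian)
    (h1 : S *ᵥ 1 = 0) (hpos : 0 < eig (K - 1) S) {x : Fin K → ℝ} (hx : ∑ k, x k = 0) :
    eig (K - 1) S * (x ⬝ᵥ x) ≤ x ⬝ᵥ S *ᵥ x := by
  have hlt : K - 1 - 1 < Fintype.card (Fin K) := by simp; omega
  have heig : eig (K - 1) S = hS.eigenvalues₀ ⟨K - 1 - 1, hlt⟩ := by
    unfold eig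
    rw [dif_pos ⟨hS, hlt⟩]
  set e : Fin (Fintype.card (Fin K)) ≃ Fin K := Fintype.equivOfCardEq (Fintype.card_fin _) with he
  have hlast : K - 1 < Fintype.card (Fin K) := by simp; omega
  -- `eigenvalues₀` is decreasing and indexed from zero, so `λ_{K-1}` sits at position `K - 2` and
  -- `i₀` labels the smallest eigenvalue, at position `K - 1`.
  set i₀ : Fin K := e ⟨K - 1, hlast⟩
  have hge : ∀ i, i ≠ i₀ → eig (K - 1) S ≤ hS.eigenvalues i := by
    intro i hi
    rw [heig]
    apply hS.eigenvalues₀_antitone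
    rw [Fin.le_def]
    have h2 : (e.symm i).val ≠ K - 1 := fun h => hi (by
      rw [← e.apply_symm_apply i]
      exact congrArg e (Fin.ext h))
    have h3 := (e.symm i).isLt
    have h3' : (e.symm i).val < K := by simpa using h3
    change (e.symm i).val ≤ K - 1 - 1
    omega
  -- Eigenvectors with positive eigenvalue are orthogonal to the kernel vector `1`. Hence `1` is
  -- parallel to the eigenvector `i₀`, and a vector of sum zero has no component along it.
  have hv1 : ∀ i, i ≠ i₀ → (hS.eigenvectorBasis i).ofLp ⬝ᵥ 1 = 0 := by
    intro i hi
    have := IsHermitian.dotProduct_mulVec_eigenvectorBasis hS i 1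
    rw [h1, dotProduct_zero] at this
    exact (mul_eq_zero.1 this.symm).resolve_left (hpos.trans_le (hge i hi)).ne'
  have hx1 : ∀ y : Fin K → ℝ, ((hS.eigenvectorBasis i₀).ofLp ⬝ᵥ 1)
      * ((hS.eigenvectorBasis i₀).ofLp ⬝ᵥ y) = ∑ k, y k := by
    intro y
    rw [← one_dotProduct, ← IsHermitian.sum_eigenvectorBasis_mul hS 1 y]
    rw [Finset.sum_eq_single i₀ (fun i _ hi => by rw [hv1 i hi, zero_mul])
      fun h => absurd (Finset.mem_univ i₀) h]
  have hx0 : (hS.eigenvectorBasis i₀).ofLp ⬝ᵥ x = 0 := by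
    refine (mul_eq_zero.1 ((hx1 x).trans hx)).resolve_left fun h => ?_
    have := hx1 1
    rw [h, zero_mul] at this
    simp only [Pi.one_apply, Finset.sum_const, Finset.card_univ, Fintype.card_fin, nsmul_eq_mul,
      mul_one] at this
    have : K = 0 := by exact_mod_cast this.symm
    omega
  rw [← IsHermitian.sum_eigenvectorBasis_mul hS x x,
    ← IsHermitian.sum_eigenvectorBasis_mul hS x (S *ᵥ x), Finset.mul_sum]
  refine Finset.sum_le_sum fun i _ => ?_
  rw [IsHermitian.dotProduct_mulVec_eigenvectorBasis]
  by_cases hi : i = i₀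
  · rw [hi, hx0]; simp
  · have := mul_le_mul_of_nonneg_right (hge i hi)
      (mul_self_nonneg ((hS.eigenvectorBasis i).ofLp ⬝ᵥ x))
    linarith

lemma sq_norm_le_dotProduct {K : ℕ} (x : Fin K → ℝ) : ‖x‖ ^ 2 ≤ x ⬝ᵥ x := by
  have h0 : 0 ≤ x ⬝ᵥ x := Finset.sum_nonneg fun k _ => mul_self_nonneg (x k)
  rw [← Real.le_sqrt (norm_nonneg _) h0]
  refine (pi_norm_le_iff_of_nonneg (Real.sqrt_nonneg _)).2 fun k => ?_
  refine Real.abs_le_sqrt ?_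
  rw [sq]
  exact Finset.single_le_sum (f := fun k => x k * x k) (fun k _ => mul_self_nonneg (x k))
    (Finset.mem_univ k)

/-! ### Weighted least squares -/

/-- Nonnegative matrices with columns summing to one and no vanishing row. -/
structure IsTopic {p K : ℕ} (B : Matrix (Fin p) (Fin K) ℝ) : Prop where
  nonneg : ∀ j k, 0 ≤ B j k
  col_sum : ∀ k, ∑ j, B j k = 1
  row_pos : ∀ j, 0 < ∑ k, B j k

/-- The matrix `D⁻¹ B`, whose rows sum to one. -/
noncomputable def normRows {p K : ℕ} (B : Matrix (Fin p) (Fin K) ℝ) : Matrix (Fin p) (Fin K) ℝ :=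
  rowDiagInv B * B

/-- The variance of `g` under the weights `r`. -/
def quadVar {p : ℕ} (r g : Fin p → ℝ) : ℝ := ∑ j, r j * g j ^ 2 - (∑ j, r j * g j) ^ 2

section

variable {p K : ℕ} {B : Matrix (Fin p) (Fin K) ℝ}

lemma transpose_rowDiagInv : (rowDiagInv B)ᵀ = rowDiagInv B := Matrix.diagonal_transpose _

lemma transpose_normRows : (normRows B)ᵀ = Bᵀ * rowDiagInv B := by
  rw [normRows, Matrix.transpose_mul, transpose_rowDiagInv]

lemma gram_eq : gram B = Bᵀ * normRows B := by rw [gram, normRows, Matrix.mul_assoc]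

lemma lsInv_eq : lsInv B = (gram B)⁻¹ * (normRows B)ᵀ := by
  rw [lsInv, transpose_normRows, Matrix.mul_assoc]

lemma transpose_gram : (gram B)ᵀ = gram B := by
  rw [gram, Matrix.transpose_mul, Matrix.transpose_mul, transpose_rowDiagInv,
    Matrix.transpose_transpose, Matrix.mul_assoc]

lemma transpose_inv_gram : ((gram B)⁻¹)ᵀ = (gram B)⁻¹ := by
  rw [Matrix.transpose_nonsing_inv, transpose_gram]

lemma transpose_lsInv : (lsInv B)ᵀ = normRows B * (gram B)⁻¹ := by
  rw [lsInv_eq, Matrix.transpose_mul, Matrix.transpose_transpose, transpose_inv_gram]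

lemma vLS_eq (r : Fin p → ℝ) : vLS B r = (normRows B)ᵀ *
    (Matrix.diagonal r - Matrix.vecMulVec r r) * normRows B := by
  rw [transpose_normRows, vLS, normRows, Matrix.mul_assoc (_ * _ * _)]

lemma transpose_vLS (r : Fin p → ℝ) : (vLS B r)ᵀ = vLS B r := by
  rw [vLS_eq, Matrix.transpose_mul, Matrix.transpose_mul, Matrix.transpose_transpose,
    Matrix.transpose_sub, Matrix.diagonal_transpose, Matrix.transpose_vecMulVec, Matrix.mul_assoc]

lemma dotProduct_vLS (r : Fin p → ℝ) (x : Fin K → ℝ) :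
    x ⬝ᵥ vLS B r *ᵥ x = quadVar r (normRows B *ᵥ x) := by
  rw [vLS_eq, ← Matrix.mulVec_mulVec, ← Matrix.mulVec_mulVec, Matrix.dotProduct_mulVec,
    Matrix.vecMul_transpose, Matrix.sub_mulVec, dotProduct_sub]
  set g := normRows B *ᵥ x
  congr 1
  · simp only [dotProduct, Matrix.mulVec_diagonal]
    exact Finset.sum_congr rfl fun j _ => by ring
  · rw [Matrix.vecMulVec_mulVec]
    simp only [dotProduct, Pi.smul_apply, MulOpposite.smul_eq_mul_unop, MulOpposite.unop_op]
    rw [sq, Finset.mul_sum]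
    exact Finset.sum_congr rfl fun j _ => by ring

lemma dotProduct_sigmaLS (r : Fin p → ℝ) (x : Fin K → ℝ) :
    x ⬝ᵥ sigmaLS B r *ᵥ x = ((gram B)⁻¹ *ᵥ x) ⬝ᵥ vLS B r *ᵥ ((gram B)⁻¹ *ᵥ x) := by
  rw [sigmaLS, ← Matrix.mulVec_mulVec, ← Matrix.mulVec_mulVec, Matrix.dotProduct_mulVec,
    ← Matrix.mulVec_transpose, transpose_inv_gram]

/-- The quadratic form of `Σ_LS` is the variance of a linear statistic of one multinomial draw,
which is the quantity produced by the characteristic function computation. -/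
lemma dotProduct_sigmaLS_eq_quadVar (r : Fin p → ℝ) (x : Fin K → ℝ) :
    x ⬝ᵥ sigmaLS B r *ᵥ x = quadVar r ((lsInv B)ᵀ *ᵥ x) := by
  rw [dotProduct_sigmaLS, dotProduct_vLS, transpose_lsInv, Matrix.mulVec_mulVec]

lemma quadVar_nonneg {r : Fin p → ℝ} (hr : r ∈ stdSimplex ℝ (Fin p)) (g : Fin p → ℝ) :
    0 ≤ quadVar r g := by
  have h := Finset.sum_nonneg fun j (_ : j ∈ Finset.univ) =>
    mul_nonneg (hr.1 j) (sq_nonneg (g j - ∑ i, r i * g i))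
  have e : ∑ j, r j * (g j - ∑ i, r i * g i) ^ 2 = quadVar r g := by
    set m := ∑ i, r i * g i with hm
    have : ∀ j, r j * (g j - m) ^ 2 = r j * g j ^ 2 - 2 * m * (r j * g j) + m ^ 2 * r j :=
      fun j => by ring
    simp only [this, Finset.sum_add_distrib, Finset.sum_sub_distrib, ← Finset.mul_sum, hr.2]
    rw [← hm, quadVar, ← hm]
    ring
  rwa [e] at h

variable (hB : IsTopic B)
include hB

lemma IsTopic.normRows_apply (j : Fin p) (k : Fin K) :
    normRows B j k = B j k / ∑ l, B j l := by
  rw [normRows, rowDiagInv, Matrix.diagonal_mul, div_eq_inv_mul]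
  congr 2
  exact Finset.sum_congr rfl fun l _ => abs_of_nonneg (hB.nonneg j l)

lemma IsTopic.normRows_nonneg (j : Fin p) (k : Fin K) : 0 ≤ normRows B j k := by
  rw [hB.normRows_apply]
  exact div_nonneg (hB.nonneg j k) (hB.row_pos j).le

lemma IsTopic.sum_normRows (j : Fin p) : ∑ k, normRows B j k = 1 := by
  simp only [hB.normRows_apply, ← Finset.sum_div]
  exact div_self (hB.row_pos j).ne'

lemma IsTopic.normRows_le_one (j : Fin p) (k : Fin K) : normRows B j k ≤ 1 := by
  rw [← hB.sum_normRows j]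
  exact Finset.single_le_sum (fun l _ => hB.normRows_nonneg j l) (Finset.mem_univ k)

lemma IsTopic.normRows_mulVec_one : normRows B *ᵥ 1 = 1 := by
  ext j
  simp [Matrix.mulVec, dotProduct, hB.sum_normRows]

lemma IsTopic.norm_normRows_mulVec_le (x : Fin K → ℝ) : ‖normRows B *ᵥ x‖ ≤ ‖x‖ := by
  refine (pi_norm_le_iff_of_nonneg (norm_nonneg _)).2 fun j => ?_
  rw [mulVec_apply_eq_sum]
  calc ‖∑ k, normRows B j k * x k‖ ≤ ∑ k, ‖normRows B j k * x k‖ := norm_sum_le _ _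
    _ ≤ ∑ k, normRows B j k * ‖x‖ := by
        refine Finset.sum_le_sum fun k _ => ?_
        rw [norm_mul, Real.norm_of_nonneg (hB.normRows_nonneg j k)]
        exact mul_le_mul_of_nonneg_left (norm_le_pi_norm x k) (hB.normRows_nonneg j k)
    _ = ‖x‖ := by rw [← Finset.sum_mul, hB.sum_normRows, one_mul]

lemma IsTopic.transpose_mulVec_one : Bᵀ *ᵥ 1 = 1 := by
  ext k
  simp [Matrix.mulVec, dotProduct, hB.col_sum]

/-- `D⁻¹ B` has unit row sums and `B` has unit column sums. So `M`, and with it `M⁻¹`, fixes the one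
direction that `V_LS` does not see. -/
lemma IsTopic.gram_mulVec_one : gram B *ᵥ 1 = 1 := by
  rw [gram_eq, ← Matrix.mulVec_mulVec, hB.normRows_mulVec_one, hB.transpose_mulVec_one]

lemma IsTopic.inv_gram_mulVec_one (hu : IsUnit (gram B).det) : (gram B)⁻¹ *ᵥ 1 = 1 := by
  conv_lhs => rw [← hB.gram_mulVec_one]
  rw [Matrix.mulVec_mulVec, Matrix.nonsing_inv_mul _ hu, Matrix.one_mulVec]

lemma IsTopic.sum_inv_gram_mulVec (hu : IsUnit (gram B).det) (x : Fin K → ℝ) :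
    ∑ k, ((gram B)⁻¹ *ᵥ x) k = ∑ k, x k := by
  rw [← one_dotProduct, ← one_dotProduct, Matrix.dotProduct_mulVec, ← Matrix.mulVec_transpose,
    transpose_inv_gram, hB.inv_gram_mulVec_one hu]

/-- Least squares preserves total mass, so the estimated difference of two weight vectors has
coordinate sum zero, as the comparison of polytopes requires. -/
lemma IsTopic.sum_lsInv_mulVec (hu : IsUnit (gram B).det) (x : Fin p → ℝ) :
    ∑ k, (lsInv B *ᵥ x) k = ∑ j, x j := by
  rw [lsInv_eq, ← Matrix.mulVec_mulVec, hB.sum_inv_gram_mulVec hu, ← one_dotProduct,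
    Matrix.dotProduct_mulVec, Matrix.vecMul_transpose, hB.normRows_mulVec_one, one_dotProduct]

lemma IsTopic.vLS_mulVec_one {r : Fin p → ℝ} (hr : r ∈ stdSimplex ℝ (Fin p)) :
    vLS B r *ᵥ 1 = 0 := by
  rw [vLS_eq, ← Matrix.mulVec_mulVec, hB.normRows_mulVec_one, ← Matrix.mulVec_mulVec]
  have : (Matrix.diagonal r - Matrix.vecMulVec r r) *ᵥ 1 = 0 := by
    ext j
    rw [Matrix.sub_mulVec, Matrix.vecMulVec_mulVec]
    simp [Matrix.mulVec_diagonal, hr.2, dotProduct_one]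
  rw [this, Matrix.mulVec_zero]

lemma IsTopic.isUnit_gram (hinj : ∀ v : Fin K → ℝ, B *ᵥ v = 0 → v = 0) :
    IsUnit (gram B).det := by
  rw [isUnit_iff_ne_zero]
  intro h
  obtain ⟨v, hv0, hv⟩ := Matrix.exists_mulVec_eq_zero_iff.2 h
  refine hv0 (hinj v ?_)
  have h1 : (B *ᵥ v) ⬝ᵥ (normRows B *ᵥ v) = 0 := by
    rw [← Matrix.vecMul_transpose, ← Matrix.dotProduct_mulVec, Matrix.mulVec_mulVec, ← gram_eq, hv,
      dotProduct_zero]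
  have h2 : (B *ᵥ v) ⬝ᵥ (normRows B *ᵥ v) = ∑ j, ((B *ᵥ v) j) ^ 2 / ∑ l, B j l := by
    refine Finset.sum_congr rfl fun j _ => ?_
    have : (normRows B *ᵥ v) j = (B *ᵥ v) j / ∑ l, B j l := by
      simp only [Matrix.mulVec, dotProduct, hB.normRows_apply, Finset.sum_div]
      exact Finset.sum_congr rfl fun k _ => by ring
    rw [this]
    ring
  rw [h2] at h1
  have h3 := (Finset.sum_eq_zero_iff_of_nonneg fun j _ =>
    div_nonneg (sq_nonneg _) (hB.row_pos j).le).1 h1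
  ext j
  have h4 := h3 j (Finset.mem_univ j)
  rw [div_eq_zero_iff] at h4
  exact pow_eq_zero_iff (two_ne_zero) |>.1 (h4.resolve_right (hB.row_pos j).ne')

omit hB in
lemma lsInv_mulVec_mulVec (hu : IsUnit (gram B).det) (a : Fin K → ℝ) :
    lsInv B *ᵥ (B *ᵥ a) = a := by
  rw [Matrix.mulVec_mulVec, lsInv, Matrix.mul_assoc, Matrix.mul_assoc, ← Matrix.mul_assoc Bᵀ,
    ← gram, Matrix.nonsing_inv_mul _ hu, Matrix.one_mulVec]

omit hB in
lemma gram_mulVec_lsInv_mulVec (hu : IsUnit (gram B).det) (x : Fin p → ℝ) :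
    gram B *ᵥ (lsInv B *ᵥ x) = (normRows B)ᵀ *ᵥ x := by
  rw [Matrix.mulVec_mulVec, lsInv_eq, ← Matrix.mul_assoc, Matrix.mul_nonsing_inv _ hu,
    Matrix.one_mul]

lemma IsTopic.mulVec_mem_stdSimplex {a : Fin K → ℝ} (ha : a ∈ stdSimplex ℝ (Fin K)) :
    B *ᵥ a ∈ stdSimplex ℝ (Fin p) := by
  refine ⟨fun j => ?_, ?_⟩
  · rw [mulVec_apply_eq_sum]
    exact Finset.sum_nonneg fun k _ => mul_nonneg (hB.nonneg j k) (ha.1 k)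
  rw [← one_dotProduct, Matrix.dotProduct_mulVec, ← Matrix.mulVec_transpose,
    hB.transpose_mulVec_one, one_dotProduct, ha.2]

omit hB in
lemma isHermitian_vLS (r : Fin p → ℝ) : (vLS B r).IsHermitian := by
  rw [Matrix.IsHermitian, Matrix.conjTranspose_eq_transpose_of_trivial, transpose_vLS]

/-- The test vector `e₀ - e₁` has squared length two, while the variance of its image under the
row-stochastic matrix `D⁻¹ B` is at most one. -/
lemma IsTopic.eig_vLS_le_one (hK : 2 ≤ K) {r : Fin p → ℝ} (hr : r ∈ stdSimplex ℝ (Fin p))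
    (hpos : 0 < eig (K - 1) (vLS B r)) : eig (K - 1) (vLS B r) ≤ 1 := by
  let k₀ : Fin K := ⟨0, by omega⟩
  let k₁ : Fin K := ⟨1, by omega⟩
  have hne : k₀ ≠ k₁ := by simp [k₀, k₁]
  set x : Fin K → ℝ := Pi.single k₀ 1 - Pi.single k₁ 1 with hx
  have hsum : ∑ k, x k = 0 := by simp [hx]
  have h := eig_mul_le hK (isHermitian_vLS r) (hB.vLS_mulVec_one hr) hpos hsum
  have hxx : x ⬝ᵥ x = 2 := by
    simp only [hx, dotProduct_sub, dotProduct_single_one, Pi.sub_apply, Pi.single_eq_same,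
      Pi.single_eq_of_ne hne, Pi.single_eq_of_ne hne.symm]
    norm_num
  have hxnorm : ‖x‖ ≤ 1 := by
    refine (pi_norm_le_iff_of_nonneg zero_le_one).2 fun k => ?_
    rw [hx, Pi.sub_apply, Pi.single_apply, Pi.single_apply]
    split_ifs <;> norm_num
  have hV : x ⬝ᵥ vLS B r *ᵥ x ≤ 1 := by
    rw [dotProduct_vLS, quadVar]
    have h1 : ∑ j, r j * (normRows B *ᵥ x) j ^ 2 ≤ ∑ j, r j * 1 := by
      refine Finset.sum_le_sum fun j _ => mul_le_mul_of_nonneg_left ?_ (hr.1 j)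
      have := (norm_le_pi_norm _ j).trans ((hB.norm_normRows_mulVec_le x).trans hxnorm)
      rwa [Real.norm_eq_abs, ← sq_le_one_iff_abs_le_one] at this
    simp only [mul_one, hr.2] at h1
    linarith [sq_nonneg (∑ j, r j * (normRows B *ᵥ x) j)]
  rw [hxx] at h
  linarith

/-- The inverse Gram matrix is controlled by the covariance matrix of the least squares estimator
and by the smallest relevant eigenvalue of `V_LS`. -/
lemma IsTopic.norm_inv_gram_mulVec_le (hK : 2 ≤ K) (hu : IsUnit (gram B).det) {r : Fin p → ℝ}
    (hr : r ∈ stdSimplex ℝ (Fin p)) {lam : ℝ} (hpos : 0 < lam)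
    (hlam : lam ≤ eig (K - 1) (vLS B r)) {C : ℝ}
    (hC : ∀ x, x ⬝ᵥ sigmaLS B r *ᵥ x ≤ C * ‖x‖ ^ 2) (x : Fin K → ℝ) :
    ‖(gram B)⁻¹ *ᵥ x‖ ≤ √((C + K) / lam) * ‖x‖ := by
  set y := (gram B)⁻¹ *ᵥ x with hy
  have hK0 : (0 : ℝ) < K := by positivity
  have hlam1 : lam ≤ 1 := hlam.trans (hB.eig_vLS_le_one hK hr (hpos.trans_le hlam))
  have hsy : ∑ k, y k = ∑ k, x k := hB.sum_inv_gram_mulVec hu x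
  set m : ℝ := (∑ k, x k) / K with hm
  set z : Fin K → ℝ := y - m • 1 with hz
  have hzsum : ∑ k, z k = 0 := by
    simp only [hz, Pi.sub_apply, Pi.smul_apply, Pi.one_apply, smul_eq_mul, mul_one,
      Finset.sum_sub_distrib, Finset.sum_const, Finset.card_univ, Fintype.card_fin, nsmul_eq_mul,
      hsy, hm]
    field_simp
    ring
  have hV1 := hB.vLS_mulVec_one hr
  have hVz : z ⬝ᵥ vLS B r *ᵥ z = y ⬝ᵥ vLS B r *ᵥ y := by
    have e1 : vLS B r *ᵥ z = vLS B r *ᵥ y := by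
      rw [hz, Matrix.mulVec_sub, Matrix.mulVec_smul, hV1, smul_zero, sub_zero]
    have e2 : (1 : Fin K → ℝ) ⬝ᵥ vLS B r *ᵥ y = 0 := by
      rw [Matrix.dotProduct_mulVec, ← Matrix.mulVec_transpose, transpose_vLS, hV1, zero_dotProduct]
    rw [e1, hz, sub_dotProduct, smul_dotProduct, e2, smul_zero, sub_zero]
  have h1 := eig_mul_le hK (isHermitian_vLS r) hV1 (hpos.trans_le hlam) hzsum
  have hzz : 0 ≤ z ⬝ᵥ z := Finset.sum_nonneg fun k _ => mul_self_nonneg (z k)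
  have h2 : lam * (z ⬝ᵥ z) ≤ C * ‖x‖ ^ 2 := by
    have h3 := hC x
    rw [dotProduct_sigmaLS, ← hy, ← hVz] at h3
    exact (mul_le_mul_of_nonneg_right hlam hzz).trans (h1.trans h3)
  have h4 : y ⬝ᵥ y = z ⬝ᵥ z + K * m ^ 2 := by
    have : y = z + m • 1 := by rw [hz]; abel
    rw [this, add_dotProduct, dotProduct_add, dotProduct_add, smul_dotProduct, dotProduct_smul,
      smul_dotProduct, dotProduct_one, one_dotProduct, hzsum, dotProduct_smul, one_dotProduct]
    simp
    ring
  have h5 : K * m ^ 2 ≤ K * ‖x‖ ^ 2 := by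
    have : |m| ≤ ‖x‖ := by
      have := (abs_dotProduct_le 1 x)
      rw [one_dotProduct] at this
      have h1 : ‖(1 : Fin K → ℝ)‖ ≤ 1 :=
        (pi_norm_le_iff_of_nonneg zero_le_one).2 fun k => by simp
      rw [hm, abs_div, abs_of_pos hK0, div_le_iff₀ hK0]
      refine this.trans ?_
      have : K * ‖(1 : Fin K → ℝ)‖ * ‖x‖ ≤ K * 1 * ‖x‖ := by gcongr
      linarith
    have := sq_le_sq' (by linarith [neg_abs_le m]) ((le_abs_self m).trans this)
    gcongr
  have h6 : lam * ‖y‖ ^ 2 ≤ (C + K) * ‖x‖ ^ 2 := by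
    have h7 := sq_norm_le_dotProduct y
    have h8 : lam * (K * m ^ 2) ≤ 1 * (K * ‖x‖ ^ 2) := by gcongr
    calc lam * ‖y‖ ^ 2 ≤ lam * (y ⬝ᵥ y) := by gcongr
      _ ≤ _ := by rw [h4]; linarith
  have hCK : 0 ≤ C + K := by
    have := hC 1
    have h1 : ‖(1 : Fin K → ℝ)‖ = 1 := by
      have : Nonempty (Fin K) := ⟨⟨0, by omega⟩⟩
      simp
    rw [dotProduct_sigmaLS_eq_quadVar, h1] at this
    have := quadVar_nonneg hr ((lsInv B)ᵀ *ᵥ 1)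
    linarith
  rw [← Real.sqrt_sq (norm_nonneg y), ← Real.sqrt_sq (norm_nonneg x), ← Real.sqrt_mul (by positivity)]
  refine Real.sqrt_le_sqrt ?_
  rw [div_mul_eq_mul_div, le_div_iff₀ hpos]
  linarith

lemma IsTopic.abs_transpose_lsInv_le {b : ℝ} (hb : ∀ x, ‖(gram B)⁻¹ *ᵥ x‖ ≤ b * ‖x‖)
    (v : Fin K → ℝ) (j : Fin p) : |((lsInv B)ᵀ *ᵥ v) j| ≤ b * ‖v‖ := by
  rw [transpose_lsInv, ← Matrix.mulVec_mulVec]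
  exact (norm_le_pi_norm _ j).trans ((hB.norm_normRows_mulVec_le _).trans (hb v))

end

/-! ### Perturbation of the least squares estimator -/

section

variable {p K : ℕ} {A B : Matrix (Fin p) (Fin K) ℝ} (hA : IsTopic A) (hB : IsTopic B)
  {ε : ℝ} (hcol : ∀ k, ∑ j, |B j k - A j k| ≤ ε) (hrow : ∀ j, ∑ k, |B j k - A j k| ≤ ε * ∑ k, A j k)
include hA hB hrow

/-- One `ε` comes from the change of the entry and one from the change of the row sum, both relative
to the row sum of `A`. This is why the row error has to be measured relatively. -/
lemma abs_normRows_sub_le (j : Fin p) (k : Fin K) :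
    |normRows B j k - normRows A j k| ≤ 2 * ε := by
  have hD := hA.row_pos j
  have hD' := hB.row_pos j
  have h1 : |B j k - A j k| ≤ ε * ∑ k, A j k :=
    (Finset.single_le_sum (f := fun k => |B j k - A j k|) (fun _ _ => abs_nonneg _)
      (Finset.mem_univ k)).trans (hrow j)
  have h2 : |∑ l, A j l - ∑ l, B j l| ≤ ε * ∑ k, A j k := by
    rw [← Finset.sum_sub_distrib]
    refine (Finset.abs_sum_le_sum_abs _ _).trans (le_trans (le_of_eq ?_) (hrow j))
    exact Finset.sum_congr rfl fun l _ => abs_sub_comm _ _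
  have e : normRows B j k - normRows A j k = (B j k - A j k) / (∑ l, A j l)
      + normRows B j k * ((∑ l, A j l - ∑ l, B j l) / ∑ l, A j l) := by
    rw [hA.normRows_apply, hB.normRows_apply]
    field_simp
    ring
  have h3 : |(B j k - A j k) / (∑ l, A j l)| ≤ ε := by
    rwa [abs_div, abs_of_pos hD, div_le_iff₀ hD]
  have h4 : |(∑ l, A j l - ∑ l, B j l) / ∑ l, A j l| ≤ ε := by
    rwa [abs_div, abs_of_pos hD, div_le_iff₀ hD]
  rw [e]
  refine (abs_add_le _ _).trans ?_
  rw [abs_mul, abs_of_nonneg (hB.normRows_nonneg j k)]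
  have := mul_le_mul (hB.normRows_le_one j k) h4 (abs_nonneg _) zero_le_one
  linarith

include hcol in
-- Split as `(B - A)ᵀ D_B⁻¹ B + Aᵀ (D_B⁻¹ B - D_A⁻¹ A)`: the column error gives `ε`, and the
-- entrywise bound `2 ε` is averaged over a column of `A`, which has mass one. No factor of `p`
-- appears.
lemma abs_gram_sub_le (k l : Fin K) : |gram B k l - gram A k l| ≤ 3 * ε := by
  have e : gram B k l - gram A k l = ∑ j, ((B j k - A j k) * normRows B j l
      + A j k * (normRows B j l - normRows A j l)) := by
    rw [gram_eq, gram_eq, Matrix.mul_apply, Matrix.mul_apply, ← Finset.sum_sub_distrib]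
    refine Finset.sum_congr rfl fun j _ => ?_
    simp only [Matrix.transpose_apply]
    ring
  rw [e]
  refine (Finset.abs_sum_le_sum_abs _ _).trans ?_
  have h : ∀ j, |(B j k - A j k) * normRows B j l + A j k * (normRows B j l - normRows A j l)|
      ≤ |B j k - A j k| + A j k * (2 * ε) := by
    intro j
    refine (abs_add_le _ _).trans ?_
    rw [abs_mul, abs_mul, abs_of_nonneg (hB.normRows_nonneg j l), abs_of_nonneg (hA.nonneg j k)]
    have h1 := mul_le_mul_of_nonneg_left (hB.normRows_le_one j l) (abs_nonneg (B j k - A j k))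
    have h2 := mul_le_mul_of_nonneg_left (abs_normRows_sub_le hA hB hrow j l) (hA.nonneg j k)
    linarith
  refine (Finset.sum_le_sum fun j _ => h j).trans ?_
  rw [Finset.sum_add_distrib, ← Finset.sum_mul, hA.col_sum]
  linarith [hcol k]

lemma norm_transpose_normRows_sub_mulVec_le (hε : 0 ≤ ε) (x : Fin p → ℝ) :
    ‖(normRows B)ᵀ *ᵥ x - (normRows A)ᵀ *ᵥ x‖ ≤ 2 * ε * ∑ j, |x j| := by
  have h0 : 0 ≤ ∑ j, |x j| := Finset.sum_nonneg fun _ _ => abs_nonneg _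
  refine (pi_norm_le_iff_of_nonneg (by positivity)).2 fun k => ?_
  rw [← Matrix.sub_mulVec, Finset.mul_sum, Real.norm_eq_abs, mulVec_apply_eq_sum]
  refine (Finset.abs_sum_le_sum_abs _ _).trans (Finset.sum_le_sum fun j _ => ?_)
  rw [abs_mul]
  exact mul_le_mul_of_nonneg_right (abs_normRows_sub_le hA hB hrow j k) (abs_nonneg _)

include hcol in
lemma norm_gram_sub_mulVec_le (hε : 0 ≤ ε) (x : Fin K → ℝ) :
    ‖gram B *ᵥ x - gram A *ᵥ x‖ ≤ 3 * K * ε * ‖x‖ := by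
  refine (pi_norm_le_iff_of_nonneg (by positivity)).2 fun k => ?_
  rw [← Matrix.sub_mulVec, Real.norm_eq_abs, mulVec_apply_eq_sum]
  refine (Finset.abs_sum_le_sum_abs _ _).trans ?_
  calc ∑ l, |(gram B - gram A) k l * x l| ≤ ∑ _l : Fin K, 3 * ε * ‖x‖ := by
        refine Finset.sum_le_sum fun l _ => ?_
        rw [abs_mul]
        exact mul_le_mul (abs_gram_sub_le hA hB hcol hrow k l) (norm_le_pi_norm x l)
          (abs_nonneg _) (by positivity)
    _ = _ := by simp; ring

include hcol in
lemma isUnit_gram_of_close (hε : 0 ≤ ε) (hu : IsUnit (gram A).det) {b : ℝ} (hb0 : 0 ≤ b)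
    (hb : ∀ x, ‖(gram A)⁻¹ *ᵥ x‖ ≤ b * ‖x‖) (hsmall : 6 * K * (b * ε) ≤ 1) :
    IsUnit (gram B).det := by
  rw [isUnit_iff_ne_zero]
  intro h
  obtain ⟨v, hv0, hv⟩ := Matrix.exists_mulVec_eq_zero_iff.2 h
  have h1 := norm_gram_sub_mulVec_le hA hB hcol hrow hε v
  rw [hv, zero_sub, norm_neg] at h1
  have h2 := hb (gram A *ᵥ v)
  rw [Matrix.mulVec_mulVec, Matrix.nonsing_inv_mul _ hu, Matrix.one_mulVec] at h2
  have h3 := mul_le_mul_of_nonneg_left h1 hb0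
  have h4 := mul_le_mul_of_nonneg_right hsmall (norm_nonneg v)
  have h5 : 0 < ‖v‖ := norm_pos_iff.2 hv0
  linarith

include hcol in
/-- Stability of the least squares estimator under perturbation of the mixture components. -/
lemma norm_lsInv_sub_le (hε : 0 ≤ ε) (hu : IsUnit (gram A).det) {b : ℝ} (hb0 : 0 ≤ b)
    (hb : ∀ x, ‖(gram A)⁻¹ *ᵥ x‖ ≤ b * ‖x‖) (hsmall : 6 * K * (b * ε) ≤ 1)
    {x : Fin p → ℝ} (hx : ∑ j, |x j| ≤ 2) {u : Fin K → ℝ} (huu : ‖u‖ ≤ 1) :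
    ‖lsInv B *ᵥ x - lsInv A *ᵥ x‖
      ≤ (6 * K + 8) * (b * ε) * (1 + ‖lsInv A *ᵥ x - u‖) := by
  have hu' := isUnit_gram_of_close hA hB hcol hrow hε hu hb0 hb hsmall
  set T := lsInv A *ᵥ x with hT
  set T' := lsInv B *ᵥ x with hT'
  -- Subtraction of the two normal equations, with `T' = (T' - T) + (T - u) + u` in the Gram error.
  -- The first term is absorbed on the left, the second is the fluctuation about `u`, and the third
  -- is bounded.
  have e : T' - T = (gram A)⁻¹ *ᵥ (((normRows B)ᵀ *ᵥ x - (normRows A)ᵀ *ᵥ x)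
      - (gram B *ᵥ (T' - T) - gram A *ᵥ (T' - T))
      - (gram B *ᵥ (T - u) - gram A *ᵥ (T - u)) - (gram B *ᵥ u - gram A *ᵥ u)) := by
    rw [← gram_mulVec_lsInv_mulVec hu, ← gram_mulVec_lsInv_mulVec hu', ← hT, ← hT']
    simp only [Matrix.mulVec_sub]
    have : (gram B *ᵥ T' - gram A *ᵥ T - (gram B *ᵥ T' - gram B *ᵥ T - (gram A *ᵥ T' - gram A *ᵥ T))
        - (gram B *ᵥ T - gram B *ᵥ u - (gram A *ᵥ T - gram A *ᵥ u)) - (gram B *ᵥ u - gram A *ᵥ u))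
        = gram A *ᵥ T' - gram A *ᵥ T := by abel
    have h2 := congrArg (fun y => (gram A)⁻¹ *ᵥ y) this
    simp only [Matrix.mulVec_sub, Matrix.mulVec_mulVec (M := (gram A)⁻¹) (N := gram A),
      Matrix.nonsing_inv_mul _ hu, Matrix.one_mulVec] at h2 ⊢
    rw [← h2]
    abel
  have h1 := norm_transpose_normRows_sub_mulVec_le hA hB hrow hε x
  have h2 := norm_gram_sub_mulVec_le hA hB hcol hrow hε (T' - T)
  have h3 := norm_gram_sub_mulVec_le hA hB hcol hrow hε (T - u)
  have h4 := norm_gram_sub_mulVec_le hA hB hcol hrow hε u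
  have h5 : ‖T' - T‖ ≤ b * (4 * ε + 3 * K * ε * ‖T' - T‖ + 3 * K * ε * ‖T - u‖ + 3 * K * ε) := by
    conv_lhs => rw [e]
    refine (hb _).trans (mul_le_mul_of_nonneg_left ?_ hb0)
    refine (norm_sub_le _ _).trans (add_le_add ((norm_sub_le _ _).trans (add_le_add
      ((norm_sub_le _ _).trans (add_le_add (h1.trans ?_) h2)) h3)) (h4.trans ?_))
    · have := mul_le_mul_of_nonneg_left hx (mul_nonneg zero_le_two hε)
      linarith
    · exact mul_le_of_le_one_right (by positivity) huu
  -- By `hsmall` the coefficient `3 K b ε` of `‖T' - T‖` is at most one half. Absorbing that term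
  -- doubles `4 + 3 K`, which gives `6 K + 8`.
  have h6 := mul_le_mul_of_nonneg_right hsmall (norm_nonneg (T' - T))
  have h7 : 0 ≤ (b * ε) * ‖T - u‖ := by positivity
  nlinarith

end

/-! ### Relabelling of columns -/

lemma normRows_submatrix {p K : ℕ} (B : Matrix (Fin p) (Fin K) ℝ) (τ : Equiv.Perm (Fin K)) :
    normRows (B.submatrix id τ) = (normRows B).submatrix id τ := by
  ext j k
  simp only [normRows, rowDiagInv, Matrix.diagonal_mul, Matrix.submatrix_apply, id]
  rw [Equiv.sum_comp τ fun k => |B j k|]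

lemma gram_submatrix {p K : ℕ} (B : Matrix (Fin p) (Fin K) ℝ) (τ : Equiv.Perm (Fin K)) :
    gram (B.submatrix id τ) = (gram B).submatrix τ τ := by
  rw [gram_eq, gram_eq, normRows_submatrix]
  ext k l
  simp [Matrix.mul_apply]

lemma lsInv_submatrix_mulVec {p K : ℕ} (B : Matrix (Fin p) (Fin K) ℝ) (τ : Equiv.Perm (Fin K))
    (x : Fin p → ℝ) : lsInv (B.submatrix id τ) *ᵥ x = (lsInv B *ᵥ x) ∘ τ := by
  have : lsInv (B.submatrix id τ) = (lsInv B).submatrix τ id := by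
    rw [lsInv_eq, lsInv_eq, gram_submatrix, normRows_submatrix, Matrix.inv_submatrix_equiv,
      Matrix.transpose_submatrix, Matrix.submatrix_mul_equiv]
  rw [this]
  ext k
  simp [Matrix.mulVec, dotProduct]

end TopicLS

namespace TopicLS

/-! ### Characteristic functions of multinomial sums -/

lemma norm_pow_sub_pow_le {z w : ℂ} (hz : ‖z‖ ≤ 1) (hw : ‖w‖ ≤ 1) (n : ℕ) :
    ‖z ^ n - w ^ n‖ ≤ n * ‖z - w‖ := by
  induction n with
  | zero => simp
  | succ n ih =>
    have e : z ^ (n + 1) - w ^ (n + 1) = z * (z ^ n - w ^ n) + (z - w) * w ^ n := by ring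
    rw [e]
    refine (norm_add_le _ _).trans ?_
    rw [norm_mul, norm_mul, norm_pow]
    have h1 : ‖z‖ * ‖z ^ n - w ^ n‖ ≤ 1 * (n * ‖z - w‖) := by gcongr
    have h2 : ‖z - w‖ * ‖w‖ ^ n ≤ ‖z - w‖ * 1 := by gcongr; exact pow_le_one₀ (norm_nonneg _) hw
    push_cast
    linarith

/-- Both sides are compared with `1 - V / 2`, `V` being the variance. The third order Taylor
remainder averages to at most `β V`, and the remainder of the real exponential is of order `V ^ 2 ≤
β V`, since `V ≤ β ^ 2 ≤ β`. -/
lemma norm_sum_mul_exp_sub_le {p : ℕ} {r : Fin p → ℝ} (hr : r ∈ stdSimplex ℝ (Fin p))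
    {h : Fin p → ℝ} (h0 : ∑ j, r j * h j = 0) {β : ℝ} (hβ1 : β ≤ 1) (hβ : ∀ j, |h j| ≤ β) :
    ‖∑ j, (r j : ℂ) * Complex.exp (h j * Complex.I)
      - Complex.exp ((-(∑ j, r j * h j ^ 2) / 2 : ℝ))‖ ≤ 2 * β * ∑ j, r j * h j ^ 2 := by
  set V := ∑ j, r j * h j ^ 2 with hV
  have hne : ∃ j : Fin p, True := by
    by_contra hcon
    push Not at hcon
    have := hr.2
    rw [Finset.sum_eq_zero (fun j _ => (hcon j).elim)] at this
    norm_num at this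
  obtain ⟨j₀, -⟩ := hne
  have hβ0 : 0 ≤ β := (abs_nonneg _).trans (hβ j₀)
  have hsq : ∀ j, h j ^ 2 ≤ β ^ 2 := fun j => sq_le_sq' (by linarith [neg_abs_le (h j), hβ j])
    ((le_abs_self _).trans (hβ j))
  have hV0 : 0 ≤ V := Finset.sum_nonneg fun j _ => mul_nonneg (hr.1 j) (sq_nonneg _)
  have hVβ : V ≤ β ^ 2 := by
    calc V ≤ ∑ j, r j * β ^ 2 :=
          Finset.sum_le_sum fun j _ => mul_le_mul_of_nonneg_left (hsq j) (hr.1 j)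
      _ = β ^ 2 := by rw [← Finset.sum_mul, hr.2, one_mul]
  have hββ : β ^ 2 ≤ β := by nlinarith
  have e1 : ∑ j, (r j : ℂ) * (1 + h j * Complex.I - (h j : ℂ) ^ 2 / 2) = ((1 - V / 2 : ℝ) : ℂ) := by
    have h1 : (∑ j, (r j : ℂ)) = 1 := by exact_mod_cast congrArg (fun x : ℝ => (x : ℂ)) hr.2
    have h2 : (∑ j, (r j : ℂ) * h j) = 0 := by exact_mod_cast congrArg (fun x : ℝ => (x : ℂ)) h0
    have h3 : (∑ j, (r j : ℂ) * (h j : ℂ) ^ 2) = V := by rw [hV]; push_cast; rfl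
    have : ∀ j, (r j : ℂ) * (1 + h j * Complex.I - (h j : ℂ) ^ 2 / 2)
        = r j + Complex.I * (r j * h j) - (r j * (h j : ℂ) ^ 2) / 2 := fun j => by ring
    simp only [this, Finset.sum_add_distrib, Finset.sum_sub_distrib, ← Finset.mul_sum,
      ← Finset.sum_div, h1, h2, h3]
    push_cast
    ring
  have e2 : ‖∑ j, (r j : ℂ) * Complex.exp (h j * Complex.I) - ((1 - V / 2 : ℝ) : ℂ)‖
      ≤ β * V := by
    rw [← e1, ← Finset.sum_sub_distrib]
    refine (norm_sum_le _ _).trans ?_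
    rw [hV, Finset.mul_sum]
    refine Finset.sum_le_sum fun j _ => ?_
    rw [← mul_sub, norm_mul, Complex.norm_real, Real.norm_of_nonneg (hr.1 j)]
    have hn : ‖(h j : ℂ) * Complex.I‖ = |h j| := by simp
    have hb := Complex.exp_bound' (x := h j * Complex.I) (n := 3) (by
      rw [hn]; have := hβ j; norm_num; linarith)
    rw [hn] at hb
    have hs : ∑ m ∈ Finset.range 3, ((h j : ℂ) * Complex.I) ^ m / (m.factorial : ℂ)
        = 1 + h j * Complex.I - (h j : ℂ) ^ 2 / 2 := by
      simp [Finset.sum_range_succ, Nat.factorial, mul_pow]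
      ring
    rw [hs] at hb
    have hcube : |h j| ^ 3 / (Nat.factorial 3 : ℝ) * 2 ≤ β * h j ^ 2 := by
      have h1 : |h j| ^ 3 = |h j| * h j ^ 2 := by rw [← sq_abs (h j)]; ring
      have h2 : |h j| * h j ^ 2 ≤ β * h j ^ 2 := by have := hβ j; gcongr
      have h3 : 0 ≤ |h j| * h j ^ 2 := by positivity
      rw [h1]
      norm_num [Nat.factorial]
      linarith
    calc _ ≤ r j * (β * h j ^ 2) := mul_le_mul_of_nonneg_left (hb.trans hcube) (hr.1 j)
      _ = _ := by ring
  have e3 : ‖((1 - V / 2 : ℝ) : ℂ) - Complex.exp ((-V / 2 : ℝ))‖ ≤ β * V := by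
    rw [← Complex.ofReal_exp, ← Complex.ofReal_sub, Complex.norm_real]
    have h1 : |(-V / 2)| = V / 2 := by rw [abs_div, abs_neg, abs_of_nonneg hV0]; norm_num
    have := Real.norm_exp_sub_one_sub_id_le (x := -V / 2) (by
      rw [Real.norm_eq_abs, h1]; linarith)
    rw [Real.norm_eq_abs (-V / 2), h1] at this
    have e : Real.exp (-V / 2) - (1 - V / 2) = Real.exp (-V / 2) - 1 - (-V / 2) := by ring
    rw [norm_sub_rev, e]
    refine this.trans ?_
    nlinarith
  calc _ ≤ _ := norm_sub_le_norm_sub_add_norm_sub _ ((1 - V / 2 : ℝ) : ℂ) _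
    _ ≤ β * V + β * V := add_le_add e2 e3
    _ = _ := by ring

lemma isProbabilityMeasure_categorical {p : ℕ} {r : Fin p → ℝ} (hr : r ∈ stdSimplex ℝ (Fin p)) :
    IsProbabilityMeasure (categorical r) := by
  constructor
  simp only [categorical, Measure.coe_finsetSum, Measure.coe_smul, Finset.sum_apply,
    Pi.smul_apply, measure_univ, smul_eq_mul, mul_one]
  rw [← ENNReal.ofReal_sum_of_nonneg fun j _ => hr.1 j, hr.2, ENNReal.ofReal_one]

lemma integral_categorical {p : ℕ} {r : Fin p → ℝ} (hr : r ∈ stdSimplex ℝ (Fin p))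
    (f : Fin p → ℂ) : ∫ j, f j ∂(categorical r) = ∑ j, (r j : ℂ) * f j := by
  rw [categorical, integral_finsetSum_measure]
  · refine Finset.sum_congr rfl fun j _ => ?_
    rw [integral_smul_measure, integral_dirac, ENNReal.toReal_ofReal (hr.1 j),
      Complex.real_smul]
  · intro j _
    exact (integrable_dirac (by simp)).smul_measure ENNReal.ofReal_ne_top

lemma sum_mul_card_filter {p N : ℕ} (g : Fin p → ℝ) (z : Fin N → Fin p) :
    ∑ j, g j * ((Finset.univ.filter fun s => z s = j).card : ℝ) = ∑ s, g (z s) := by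
  have : ∀ j, g j * ((Finset.univ.filter fun s => z s = j).card : ℝ)
      = ∑ s, if z s = j then g j else 0 := fun j => by
    rw [← Finset.sum_filter, Finset.sum_const, nsmul_eq_mul, mul_comm]
  simp only [this]
  rw [Finset.sum_comm]
  simp

/-- A linear statistic of the counts is a sum over the `N` independent draws, so its characteristic
function is the `N`-th power of that of a single centred draw. -/
lemma integral_exp_multinomial {p N : ℕ} (hN : 0 < N) {r : Fin p → ℝ}
    (hr : r ∈ stdSimplex ℝ (Fin p)) (g : Fin p → ℝ) :
    ∫ y, Complex.exp (((√(N : ℝ) * (g ⬝ᵥ (freq N y - r)) : ℝ) : ℂ) * Complex.I)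
      ∂(multinomial N r)
      = (∑ j, (r j : ℂ) * Complex.exp ((((g j - g ⬝ᵥ r) / √(N : ℝ) : ℝ) : ℂ) * Complex.I)) ^ N := by
  have := isProbabilityMeasure_categorical hr
  have hN0 : (0 : ℝ) < N := by exact_mod_cast hN
  have hs : √(N : ℝ) ≠ 0 := (Real.sqrt_pos.2 hN0).ne'
  have hss : √(N : ℝ) * √(N : ℝ) = N := Real.mul_self_sqrt hN0.le
  have hm : Measurable fun (z : Fin N → Fin p) (j : Fin p) =>
      (Finset.univ.filter fun s => z s = j).card := measurable_of_countable _
  rw [multinomial, integral_map hm.aemeasurable (measurable_of_countable _).aestronglyMeasurable]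
  rw [← integral_categorical hr, ← Fintype.card_fin N, ← integral_fintype_prod_eq_pow,
    Fintype.card_fin]
  refine integral_congr_ae (Eventually.of_forall fun z => ?_)
  simp only
  rw [← Complex.exp_sum, ← Finset.sum_mul, ← Complex.ofReal_sum]
  congr 3
  have e1 : g ⬝ᵥ freq N (fun j => (Finset.univ.filter fun s => z s = j).card)
      = (∑ s, g (z s)) / N := by
    rw [← sum_mul_card_filter, Finset.sum_div]
    exact Finset.sum_congr rfl fun j _ => by simp only [freq]; ring
  rw [dotProduct_sub, e1, ← Finset.sum_div, Finset.sum_sub_distrib, Finset.sum_const,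
    Finset.card_univ, Fintype.card_fin, nsmul_eq_mul]
  field_simp
  rw [sq, hss]

/-- Taking `N`-th powers multiplies the one-draw error by at most `N`, as both factors lie in the
unit disc, and `N` times the variance of one rescaled draw is `quadVar r g`. The bound does not
involve `p`. -/
lemma norm_integral_exp_multinomial_sub_le {p N : ℕ} (hN : 0 < N) {r : Fin p → ℝ}
    (hr : r ∈ stdSimplex ℝ (Fin p)) {g : Fin p → ℝ} {β : ℝ} (hβ : ∀ j, |g j| ≤ β)
    (hsmall : 2 * β / √(N : ℝ) ≤ 1) :
    ‖∫ y, Complex.exp (((√(N : ℝ) * (g ⬝ᵥ (freq N y - r)) : ℝ) : ℂ) * Complex.I)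
        ∂(multinomial N r) - Complex.exp ((-(quadVar r g) / 2 : ℝ))‖
      ≤ 4 * (β / √(N : ℝ)) * quadVar r g := by
  have hN0 : (0 : ℝ) < N := by exact_mod_cast hN
  have hs : 0 < √(N : ℝ) := Real.sqrt_pos.2 hN0
  have hss : √(N : ℝ) ^ 2 = N := Real.sq_sqrt hN0.le
  rw [integral_exp_multinomial hN hr]
  set h : Fin p → ℝ := fun j => (g j - g ⬝ᵥ r) / √(N : ℝ) with hh
  have hmean : g ⬝ᵥ r = ∑ j, r j * g j := by rw [dotProduct_comm]; rfl
  have h0 : ∑ j, r j * h j = 0 := by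
    simp only [hh, mul_div_assoc', ← Finset.sum_div, mul_sub, Finset.sum_sub_distrib,
      ← Finset.sum_mul, hr.2, ← hmean]
    simp
  have hvar : N * ∑ j, r j * h j ^ 2 = quadVar r g := by
    have e : ∀ j, r j * h j ^ 2
        = (r j * g j ^ 2 - 2 * (g ⬝ᵥ r) * (r j * g j) + (g ⬝ᵥ r) ^ 2 * r j) / N := fun j => by
      simp only [hh, div_pow, hss]
      ring
    simp only [e, ← Finset.sum_div, Finset.sum_add_distrib, Finset.sum_sub_distrib,
      ← Finset.mul_sum, hr.2, ← hmean, quadVar]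
    field_simp
    ring
  have hmeanβ : |g ⬝ᵥ r| ≤ β := by
    rw [hmean]
    calc |∑ j, r j * g j| ≤ ∑ j, |r j * g j| := Finset.abs_sum_le_sum_abs _ _
      _ ≤ ∑ j, r j * β := Finset.sum_le_sum fun j _ => by
          rw [abs_mul, abs_of_nonneg (hr.1 j)]
          exact mul_le_mul_of_nonneg_left (hβ j) (hr.1 j)
      _ = β := by rw [← Finset.sum_mul, hr.2, one_mul]
  have hhβ : ∀ j, |h j| ≤ 2 * β / √(N : ℝ) := fun j => by
    simp only [hh]
    rw [abs_div, abs_of_pos hs]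
    gcongr
    refine (abs_sub _ _).trans ?_
    linarith [hβ j]
  have key := norm_sum_mul_exp_sub_le hr h0 hsmall hhβ
  set z := ∑ j, (r j : ℂ) * Complex.exp (h j * Complex.I) with hz
  have hz1 : ‖z‖ ≤ 1 := by
    refine (norm_sum_le _ _).trans (le_of_eq ?_)
    rw [← hr.2]
    refine Finset.sum_congr rfl fun j _ => ?_
    rw [norm_mul, Complex.norm_exp_ofReal_mul_I, mul_one, Complex.norm_real,
      Real.norm_of_nonneg (hr.1 j)]
  set V := ∑ j, r j * h j ^ 2 with hV
  have hV0 : 0 ≤ V := Finset.sum_nonneg fun j _ => mul_nonneg (hr.1 j) (sq_nonneg _)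
  have hw1 : ‖Complex.exp ((-V / 2 : ℝ))‖ ≤ 1 := by
    rw [Complex.norm_exp_ofReal, Real.exp_le_one_iff]
    linarith
  have e : Complex.exp ((-(quadVar r g) / 2 : ℝ)) = Complex.exp ((-V / 2 : ℝ)) ^ N := by
    rw [← Complex.exp_nat_mul, ← hvar]
    congr 1
    push_cast
    ring
  rw [e]
  refine (norm_pow_sub_pow_le hz1 hw1 N).trans ?_
  calc (N : ℝ) * ‖z - Complex.exp ((-V / 2 : ℝ))‖
      ≤ N * (2 * (2 * β / √(N : ℝ)) * V) := by gcongr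
    _ = _ := by rw [← hvar]; ring

/-- Central limit theorem for a linear image, of fixed dimension, of the difference of two
independent vectors of multinomial frequencies of growing dimension. -/
theorem tendstoInDistribution_multinomial {K : ℕ} {N p : ℕ → ℕ} (hN : Tendsto N atTop atTop)
    {Ω : ℕ → Type*} [∀ t, MeasurableSpace (Ω t)] {μ : ∀ t, Measure (Ω t)}
    [∀ t, IsProbabilityMeasure (μ t)] {r s : ∀ t, Fin (p t) → ℝ}
    (hr : ∀ t, r t ∈ stdSimplex ℝ (Fin (p t))) (hs : ∀ t, s t ∈ stdSimplex ℝ (Fin (p t)))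
    {Y Y' : ∀ t, Ω t → Fin (p t) → ℕ} (hY : ∀ t, HasLaw (Y t) (multinomial (N t) (r t)) (μ t))
    (hY' : ∀ t, HasLaw (Y' t) (multinomial (N t) (s t)) (μ t))
    (hind : ∀ t, IndepFun (Y t) (Y' t) (μ t)) (L : ∀ t, Matrix (Fin K) (Fin (p t)) ℝ)
    {b : ℕ → ℝ} (hb : Tendsto (fun t => b t / √(N t : ℝ)) atTop (𝓝 0))
    (hLb : ∀ᶠ t in atTop, ∀ v j, |((L t)ᵀ *ᵥ v) j| ≤ b t * ‖v‖)
    {Q : Matrix (Fin K) (Fin K) ℝ} (hQ : Q.PosSemidef)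
    (hvar : ∀ v, Tendsto (fun t => quadVar (r t) ((L t)ᵀ *ᵥ v) + quadVar (s t) ((L t)ᵀ *ᵥ v))
      atTop (𝓝 (v ⬝ᵥ Q *ᵥ v)))
    {Ω' : Type*} [MeasurableSpace Ω'] {μ' : Measure Ω'} [IsProbabilityMeasure μ']
    {G : Ω' → EuclideanSpace ℝ (Fin K)} (hG : HasLaw G (multivariateGaussian 0 Q) μ') :
    TendstoInDistribution (fun t ω => WithLp.toLp 2 (√(N t : ℝ) •
      (L t *ᵥ (freq (N t) (Y t ω) - freq (N t) (Y' t ω)) - L t *ᵥ (r t - s t))))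
      atTop G μ μ' := by
  have hmeas : ∀ t, AEMeasurable (fun ω => (WithLp.toLp 2 (√(N t : ℝ) •
      (L t *ᵥ (freq (N t) (Y t ω) - freq (N t) (Y' t ω)) - L t *ᵥ (r t - s t))) :
      EuclideanSpace ℝ (Fin K))) (μ t) := by
    intro t
    have hφ : ∀ φ : (Fin (p t) → ℕ) × (Fin (p t) → ℕ) → EuclideanSpace ℝ (Fin K),
        AEMeasurable (fun ω => φ (Y t ω, Y' t ω)) (μ t) := fun φ =>
      (measurable_of_countable φ).comp_aemeasurable
        ((hY t).aemeasurable.prodMk (hY' t).aemeasurable)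
    exact hφ fun y => WithLp.toLp 2 (√(N t : ℝ) •
      (L t *ᵥ (freq (N t) y.1 - freq (N t) y.2) - L t *ᵥ (r t - s t)))
  refine ⟨hmeas, hG.aemeasurable, ProbabilityMeasure.tendsto_of_tendsto_charFun fun v => ?_⟩
  simp only [ProbabilityMeasure.coe_mk]
  rw [hG.map_eq, charFun_multivariateGaussian hQ]
  set g : ∀ t, Fin (p t) → ℝ := fun t => (L t)ᵀ *ᵥ v.ofLp with hg
  let F : ∀ t, (Fin (p t) → ℝ) → (Fin (p t) → ℝ) → (Fin (p t) → ℕ) → ℂ := fun t r g y =>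
    Complex.exp (((√(N t : ℝ) * (g ⬝ᵥ (freq (N t) y - r)) : ℝ) : ℂ) * Complex.I)
  have hchar : ∀ t, charFun ((μ t).map fun ω => (WithLp.toLp 2 (√(N t : ℝ) •
      (L t *ᵥ (freq (N t) (Y t ω) - freq (N t) (Y' t ω)) - L t *ᵥ (r t - s t))) :
      EuclideanSpace ℝ (Fin K))) v
      = (∫ y, F t (r t) (g t) y ∂(multinomial (N t) (r t)))
        * ∫ y, F t (s t) (-(g t)) y ∂(multinomial (N t) (s t)) := by
    intro t
    rw [charFun_apply, integral_map (hmeas t) (by fun_prop)]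
    have hFm : ∀ r g, Measurable (F t r g) := fun r g => measurable_of_countable _
    rw [← (hY t).integral_comp (hFm _ _).aestronglyMeasurable,
      ← (hY' t).integral_comp (hFm _ _).aestronglyMeasurable]
    simp only [Function.comp_def]
    rw [← (hind t).integral_fun_comp_mul_comp (hY t).aemeasurable (hY' t).aemeasurable
      (hFm _ _).aestronglyMeasurable (hFm _ _).aestronglyMeasurable]
    refine integral_congr_ae (Eventually.of_forall fun ω => ?_)
    simp only [F]
    rw [← Complex.exp_add, ← add_mul, ← Complex.ofReal_add]
    congr 3
    rw [EuclideanSpace.inner_eq_star_dotProduct, star_trivial]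
    simp only
    rw [dotProduct_smul, smul_eq_mul, ← mul_add]
    congr 1
    rw [← Matrix.mulVec_sub, Matrix.dotProduct_mulVec, ← Matrix.mulVec_transpose]
    simp only [hg, dotProduct_sub, neg_dotProduct]
    ring
  simp only [hchar]
  have hqi : ∀ t, 0 ≤ quadVar (r t) (g t) := fun t => quadVar_nonneg (hr t) _
  have hqj : ∀ t, 0 ≤ quadVar (s t) (g t) := fun t => quadVar_nonneg (hs t) _
  have hneg : ∀ t, quadVar (s t) (-(g t)) = quadVar (s t) (g t) := fun t => by
    simp [quadVar]
  -- The Gaussian factors with the variances of stage `t` already converge to the target. It remains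
  -- to compare the multinomial factors with them.
  have hlim : Tendsto (fun t => Complex.exp ((-(quadVar (r t) (g t)) / 2 : ℝ))
      * Complex.exp ((-(quadVar (s t) (g t)) / 2 : ℝ))) atTop
      (𝓝 (Complex.exp (inner ℝ v 0 * Complex.I - v.ofLp ⬝ᵥ Q *ᵥ v.ofLp / 2))) := by
    have h1 : Tendsto (fun t => Complex.exp
        ((-(quadVar (r t) (g t) + quadVar (s t) (g t)) / 2 : ℝ))) atTop
        (𝓝 (Complex.exp ((-(v.ofLp ⬝ᵥ Q *ᵥ v.ofLp) / 2 : ℝ)))) :=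
      (Complex.continuous_exp.tendsto _).comp
        ((Complex.continuous_ofReal.tendsto _).comp (((hvar v.ofLp).neg).div_const 2))
    convert h1 using 2 with t
    · rw [← Complex.exp_add]
      congr 1
      push_cast
      ring
    · congr 1
      rw [inner_zero_right]
      push_cast
      ring
  have hβ : Tendsto (fun t => 4 * ((b t / √(N t : ℝ)) * ‖v.ofLp‖)
      * (quadVar (r t) (g t) + quadVar (s t) (g t))) atTop (𝓝 0) := by
    have := ((hb.mul_const ‖v.ofLp‖).const_mul 4).mul (hvar v.ofLp)
    simpa using this
  have hsmall : ∀ᶠ t in atTop, 2 * (b t * ‖v.ofLp‖) / √(N t : ℝ) ≤ 1 := by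
    have := (hb.mul_const ‖v.ofLp‖).const_mul 2
    rw [zero_mul, mul_zero] at this
    filter_upwards [this.eventually (eventually_le_nhds zero_lt_one)] with t ht
    calc _ = 2 * (b t / √(N t : ℝ) * ‖v.ofLp‖) := by ring
      _ ≤ 1 := ht
  refine (tendsto_iff_of_dist ?_).1 hlim
  refine squeeze_zero' (Eventually.of_forall fun _ => dist_nonneg) ?_ hβ
  filter_upwards [hsmall, hLb, hN.eventually_gt_atTop 0] with t h1 h2 h3
  have k1 := norm_integral_exp_multinomial_sub_le h3 (hr t) (g := g t) (h2 v.ofLp) h1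
  have k2 := norm_integral_exp_multinomial_sub_le h3 (hs t) (g := -(g t))
    (fun j => by rw [Pi.neg_apply, abs_neg]; exact h2 v.ofLp j) h1
  rw [hneg] at k2
  have n1 : ‖Complex.exp ((-(quadVar (s t) (g t)) / 2 : ℝ))‖ ≤ 1 := by
    rw [Complex.norm_exp_ofReal, Real.exp_le_one_iff]
    linarith [hqj t]
  have : IsProbabilityMeasure (multinomial (N t) (r t)) :=
    (hY t).isProbabilityMeasure_iff.1 inferInstance
  have n2 : ‖∫ y, F t (r t) (g t) y ∂(multinomial (N t) (r t))‖ ≤ 1 := by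
    refine (norm_integral_le_of_norm_le_const (C := 1) (Eventually.of_forall fun y => ?_)).trans
      (by simp)
    exact (Complex.norm_exp_ofReal_mul_I _).le
  rw [dist_comm, dist_eq_norm]
  set I₁ := ∫ y, F t (r t) (g t) y ∂(multinomial (N t) (r t))
  set I₂ := ∫ y, F t (s t) (-(g t)) y ∂(multinomial (N t) (s t))
  set E₁ := Complex.exp ((-(quadVar (r t) (g t)) / 2 : ℝ))
  set E₂ := Complex.exp ((-(quadVar (s t) (g t)) / 2 : ℝ))
  have e : I₁ * I₂ - E₁ * E₂ = I₁ * (I₂ - E₂) + (I₁ - E₁) * E₂ := by ring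
  rw [e]
  refine (norm_add_le _ _).trans ?_
  rw [norm_mul, norm_mul]
  have m1 : ‖I₁‖ * ‖I₂ - E₂‖ ≤ 1 * (4 * (b t * ‖v.ofLp‖ / √(N t : ℝ)) * quadVar (s t) (g t)) := by
    gcongr
  have m2 : ‖I₁ - E₁‖ * ‖E₂‖ ≤ (4 * (b t * ‖v.ofLp‖ / √(N t : ℝ)) * quadVar (r t) (g t)) * 1 :=
    mul_le_mul k1 n1 (norm_nonneg _) ((norm_nonneg _).trans k1)
  refine (add_le_add m1 m2).trans (le_of_eq ?_)
  ring

end TopicLS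

namespace TopicLS

/-! ### Convergence in distribution along varying probability spaces -/

section

variable {Ω : ℕ → Type*} [∀ t, MeasurableSpace (Ω t)] {μ : ∀ t, Measure (Ω t)}
  [∀ t, IsProbabilityMeasure (μ t)] {Ω' : Type*} [MeasurableSpace Ω'] {μ' : Measure Ω'}
  [IsProbabilityMeasure μ']

/-- If `X` converges in distribution to `Z` and `S - X` converges to zero in probability, then `S`
converges in distribution to `Z`. -/
theorem tendstoInDistribution_of_sub {X S : ∀ t, Ω t → ℝ} {Z : Ω' → ℝ}
    (hX : TendstoInDistribution X atTop Z μ μ') (hS : ∀ t, AEMeasurable (S t) (μ t))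
    (hXS : ∀ ε > 0, Tendsto (fun t => μ t {ω | ε ≤ |S t ω - X t ω|}) atTop (𝓝 0)) :
    TendstoInDistribution S atTop Z μ μ' := by
  have hXm := hX.forall_aemeasurable
  refine ⟨hS, hX.aemeasurable_limit, ?_⟩
  -- Bounded Lipschitz test functions suffice: the Lipschitz bound is used where `S` and `X` are
  -- `δ`-close, and the bound `M` on the oscillation elsewhere.
  have hXt := tendsto_iff_forall_lipschitz_integral_tendsto.1 hX.tendsto
  refine tendsto_iff_forall_lipschitz_integral_tendsto.2 ?_
  rintro F ⟨M, hFM⟩ ⟨L, hFL⟩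
  have hFc : Continuous F := hFL.continuous
  have hM0 : 0 ≤ M := dist_nonneg.trans (hFM 0 0)
  refine (tendsto_iff_of_dist ?_).1 (hXt F ⟨M, hFM⟩ ⟨L, hFL⟩)
  simp only [ProbabilityMeasure.coe_mk]
  rw [Metric.tendsto_nhds]
  intro ε hε
  set δ : ℝ := ε / 2 / (L + 1) with hδ
  have hδ0 : 0 < δ := by positivity
  have hreal : Tendsto (fun t => (μ t).real {ω | δ ≤ |S t ω - X t ω|}) atTop (𝓝 0) := by
    have := (ENNReal.tendsto_toReal ENNReal.zero_ne_top).comp (hXS δ hδ0)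
    exact this
  have hMlim : Tendsto (fun t => M * (μ t).real {ω | δ ≤ |S t ω - X t ω|}) atTop (𝓝 0) := by
    simpa using hreal.const_mul M
  filter_upwards [hMlim.eventually_lt_const (half_pos hε)] with t ht
  rw [Real.dist_eq, sub_zero, abs_of_nonneg dist_nonneg, dist_eq_norm,
    integral_map (hXm t) (by fun_prop), integral_map (hS t) (by fun_prop)]
  have hint : ∀ {W : Ω t → ℝ}, AEMeasurable W (μ t) → Integrable (fun ω => F (W ω)) (μ t) := by
    intro W hW
    refine Integrable.of_bound (by fun_prop) (‖F 0‖ + M) (ae_of_all _ fun ω => ?_)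
    have h1 := hFM (W ω) 0
    rw [dist_eq_norm] at h1
    linarith [norm_le_norm_add_norm_sub (F 0) (F (W ω)), norm_sub_rev (F 0) (F (W ω))]
  set B := {ω | δ ≤ |S t ω - X t ω|} with hBdef
  have hB : NullMeasurableSet B (μ t) :=
    nullMeasurableSet_le aemeasurable_const ((hS t).sub (hXm t)).abs
  rw [← integral_sub (hint (hXm t)) (hint (hS t))]
  have hbound : ∀ ω, ‖F (X t ω) - F (S t ω)‖ ≤ L * δ + B.indicator (fun _ => M) ω := by
    intro ω
    rw [← dist_eq_norm]
    by_cases hω : ω ∈ B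
    · rw [Set.indicator_of_mem hω]
      have := hFM (X t ω) (S t ω)
      have : 0 ≤ L * δ := by positivity
      linarith
    · rw [Set.indicator_of_notMem hω, add_zero]
      refine (hFL.dist_le_mul _ _).trans ?_
      rw [dist_comm, Real.dist_eq]
      have : |S t ω - X t ω| ≤ δ := (not_le.1 hω).le
      gcongr
  have hindint : Integrable (B.indicator fun _ => M) (μ t) :=
    (integrable_const M).indicator₀ hB
  calc ‖∫ ω, (F (X t ω) - F (S t ω)) ∂(μ t)‖ ≤ ∫ ω, ‖F (X t ω) - F (S t ω)‖ ∂(μ t) :=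
        norm_integral_le_integral_norm _
    _ ≤ ∫ ω, (L * δ + B.indicator (fun _ => M) ω) ∂(μ t) :=
        integral_mono ((hint (hXm t)).sub (hint (hS t))).norm
          ((integrable_const _).add hindint) hbound
    _ = L * δ + M * (μ t).real B := by
        rw [integral_add (integrable_const _) hindint, integral_indicator₀ hB]
        simp [mul_comm]
    _ < ε := by
        have : L * δ ≤ ε / 2 := by
          rw [hδ, mul_div_assoc', div_le_iff₀ (by positivity)]
          nlinarith [L.coe_nonneg]
        linarith

/-- A sequence that converges in distribution is bounded in probability. -/
lemma exists_measure_norm_gt_le {E : Type*} [NormedAddCommGroup E] [InnerProductSpace ℝ E]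
    [FiniteDimensional ℝ E] [MeasurableSpace E] [BorelSpace E] {X : ∀ t, Ω t → E} {Z : Ω' → E}
    (hX : TendstoInDistribution X atTop Z μ μ') {η : ENNReal} (hη : 0 < η) :
    ∃ R : ℝ, ∀ t, μ t {ω | R < ‖X t ω‖} ≤ η := by
  have hXm := hX.forall_aemeasurable
  have hprob : ∀ t, IsProbabilityMeasure ((μ t).map (X t)) := fun t =>
    Measure.isProbabilityMeasure_map (hXm t)
  have := Measure.isProbabilityMeasure_map (μ := μ') hX.aemeasurable_limit
  have hchar := ProbabilityMeasure.tendsto_iff_tendsto_charFun.1 hX.tendsto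
  simp only [ProbabilityMeasure.coe_mk] at hchar
  -- Lévy's criterion: the pointwise limit of the characteristic functions is continuous, hence the
  -- laws are tight and one radius serves for all `t`.
  have ht := isTightMeasureSet_of_tendsto_charFun (by fun_prop) hchar
  have h2 := tendsto_measure_norm_gt_of_isTightMeasureSet ht
  obtain ⟨R, hR⟩ := (h2.eventually (eventually_le_nhds hη)).exists
  refine ⟨R, fun t => ?_⟩
  rw [iSup_range] at hR
  have h3 := (le_iSup (fun t => (μ t).map (X t) {x | R < ‖x‖}) t).trans hR
  rwa [Measure.map_apply_of_aemeasurable (hXm t)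
    (measurableSet_lt measurable_const measurable_norm)] at h3

/-- A form of the continuous mapping theorem: `S` need only be close to `g ∘ X` where `X` is
bounded. -/
theorem tendstoInDistribution_of_close {E : Type*} [NormedAddCommGroup E] [InnerProductSpace ℝ E]
    [FiniteDimensional ℝ E] [MeasurableSpace E] [BorelSpace E] {X : ∀ t, Ω t → E} {Z : Ω' → E}
    (hX : TendstoInDistribution X atTop Z μ μ') {g : E → ℝ} (hg : Continuous g)
    {S : ∀ t, Ω t → ℝ} (hS : ∀ t, AEMeasurable (S t) (μ t))
    (hclose : ∀ R : ℝ, ∀ ε > 0,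
      Tendsto (fun t => μ t {ω | ‖X t ω‖ ≤ R ∧ ε < |S t ω - g (X t ω)|}) atTop (𝓝 0)) :
    TendstoInDistribution S atTop (fun ω' => g (Z ω')) μ μ' := by
  refine tendstoInDistribution_of_sub (hX.continuous_comp hg) hS fun ε hε => ?_
  rw [ENNReal.tendsto_nhds_zero]
  intro η hη
  obtain ⟨R, hR⟩ := exists_measure_norm_gt_le hX (ENNReal.half_pos hη.ne')
  have h := ENNReal.tendsto_nhds_zero.1 (hclose R (ε / 2) (half_pos hε)) (η / 2)
    (ENNReal.half_pos hη.ne')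
  filter_upwards [h] with t ht
  calc μ t {ω | ε ≤ |S t ω - (g ∘ X t) ω|}
      ≤ μ t ({ω | R < ‖X t ω‖} ∪ {ω | ‖X t ω‖ ≤ R ∧ ε / 2 < |S t ω - g (X t ω)|}) := by
        refine measure_mono fun ω hω => ?_
        have h1 : ε ≤ |S t ω - g (X t ω)| := hω
        rcases lt_or_ge R ‖X t ω‖ with h | h
        · exact Or.inl h
        · exact Or.inr ⟨h, by linarith⟩
    _ ≤ η / 2 + η / 2 := (measure_union_le _ _).trans (add_le_add (hR t) ht)
    _ = η := ENNReal.add_halves η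

end

end TopicLS

namespace TopicLS

/-! ### Measurability of the estimator -/

section

variable {Ω : Type*} [MeasurableSpace Ω]

lemma measurable_det {n : ℕ} {M : Ω → Matrix (Fin n) (Fin n) ℝ}
    (hM : ∀ k l, Measurable fun ω => M ω k l) : Measurable fun ω => (M ω).det := by
  simp only [Matrix.det_apply]
  exact Finset.measurable_fun_sum _ fun σ _ =>
    (Finset.measurable_fun_prod _ fun k _ => hM _ _).const_smul _

lemma measurable_inv_apply {n : ℕ} {M : Ω → Matrix (Fin n) (Fin n) ℝ}
    (hM : ∀ k l, Measurable fun ω => M ω k l) (k l : Fin n) :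
    Measurable fun ω => (M ω)⁻¹ k l := by
  simp only [Matrix.inv_def, Ring.inverse_eq_inv', Matrix.smul_apply, smul_eq_mul,
    Matrix.adjugate_apply]
  refine (measurable_det hM).inv.mul (measurable_det fun i j => ?_)
  simp only [Matrix.updateRow_apply]
  split_ifs
  · exact measurable_const
  · exact hM _ _

lemma measurable_mul_apply {m n q : ℕ} {M : Ω → Matrix (Fin m) (Fin n) ℝ}
    {M' : Ω → Matrix (Fin n) (Fin q) ℝ} (hM : ∀ k l, Measurable fun ω => M ω k l)
    (hM' : ∀ k l, Measurable fun ω => M' ω k l) (k : Fin m) (l : Fin q) :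
    Measurable fun ω => (M ω * M' ω) k l := by
  simp only [Matrix.mul_apply]
  exact Finset.measurable_fun_sum _ fun j _ => (hM _ _).mul (hM' _ _)

lemma measurable_lsInv_apply {p K : ℕ} {B : Ω → Matrix (Fin p) (Fin K) ℝ}
    (hB : ∀ j k, Measurable fun ω => B ω j k) (k : Fin K) (j : Fin p) :
    Measurable fun ω => lsInv (B ω) k j := by
  have hT : ∀ k j, Measurable fun ω => (B ω)ᵀ k j := fun k j => hB j k
  have hD : ∀ i j, Measurable fun ω => rowDiagInv (B ω) i j := by
    intro i j
    simp only [rowDiagInv, Matrix.diagonal_apply]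
    split_ifs
    · exact (Finset.measurable_fun_sum _ fun k _ => (hB i k).abs).inv
    · exact measurable_const
  have hG : ∀ k l, Measurable fun ω => gram (B ω) k l :=
    measurable_mul_apply (measurable_mul_apply hT hD) hB
  exact measurable_mul_apply (measurable_mul_apply (measurable_inv_apply hG) hT) hD k j

variable {K : ℕ} [NeZero K]

lemma supportFun_dualPolytope_center (c : Matrix (Fin K) (Fin K) ℝ) (x : Fin K → ℝ) :
    supportFun (dualPolytope c) x
      = supportFun (dualPolytope c) (x - Pi.single 0 (∑ k, x k)) := by
  unfold supportFun
  congr 1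
  refine Set.image_congr fun f hf => ?_
  rw [dotProduct_sub, dotProduct_single, hf.2, zero_mul, sub_zero]

/-- This is for measurability: extended by zero off the closed set of pseudometrics, the support
function is Borel in the costs and the direction jointly. Centring at index `0`, harmless because `f
0 = 0`, makes the comparison of polytopes applicable to every direction. -/
lemma continuousOn_supportFun_dualPolytope :
    ContinuousOn (fun q : (Fin K → Fin K → ℝ) × (Fin K → ℝ) =>
      supportFun (dualPolytope (Matrix.of q.1)) q.2) {q | IsPseudo (Matrix.of q.1)} := by
  rintro ⟨c₀, x₀⟩ hc₀
  have hc₀' : IsPseudo (Matrix.of c₀) := hc₀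
  obtain ⟨R, -, hR⟩ := exists_entries_le (Matrix.of c₀)
  let δ : (Fin K → Fin K → ℝ) → ℝ := fun c => ∑ k, ∑ l, |c k l - c₀ k l|
  have hδ : ∀ c k l, |c k l - c₀ k l| ≤ δ c := fun c k l =>
    (Finset.single_le_sum (f := fun l => |c k l - c₀ k l|) (fun _ _ => abs_nonneg _)
      (Finset.mem_univ l)).trans (Finset.single_le_sum (f := fun k => ∑ l, |c k l - c₀ k l|)
      (fun _ _ => Finset.sum_nonneg fun _ _ => abs_nonneg _) (Finset.mem_univ k))
  let bound : (Fin K → Fin K → ℝ) × (Fin K → ℝ) → ℝ := fun q =>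
    K * δ q.1 * ‖q.2 - Pi.single 0 (∑ k, q.2 k)‖ + K * R * ‖q.2 - x₀‖
  have hsingle : Continuous fun q : (Fin K → Fin K → ℝ) × (Fin K → ℝ) =>
      (Pi.single 0 (∑ k, q.2 k) : Fin K → ℝ) :=
    (continuous_single (A := fun _ : Fin K => ℝ) 0).comp
      (continuous_finsetSum _ fun k _ => by fun_prop)
  have hbc : Continuous bound := by
    simp only [bound, δ]
    fun_prop
  have hb0 : bound (c₀, x₀) = 0 := by simp [bound, δ]
  refine (tendsto_iff_dist_tendsto_zero).2 ?_
  refine squeeze_zero' (Eventually.of_forall fun _ => dist_nonneg) ?_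
    ((hb0 ▸ hbc.tendsto (c₀, x₀)).mono_left nhdsWithin_le_nhds)
  filter_upwards [self_mem_nhdsWithin] with q hq
  have hq' : IsPseudo (Matrix.of q.1) := hq
  rw [Real.dist_eq]
  have h1 := hc₀'.abs_supportFun_sub_le hq' (δ := δ q.1) (hδ q.1)
    (x := q.2 - Pi.single 0 (∑ k, q.2 k)) (by simp)
  rw [← supportFun_dualPolytope_center, ← supportFun_dualPolytope_center] at h1
  have h2 := abs_supportFun_sub_le hc₀'.nonempty (fun f hf => hc₀'.norm_le_of_mem hR hf) q.2 x₀
  exact (abs_sub_le _ _ _).trans (add_le_add h1 h2)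

omit [NeZero K] in
lemma isClosed_isPseudo :
    IsClosed {q : (Fin K → Fin K → ℝ) × (Fin K → ℝ) | IsPseudo (Matrix.of q.1)} := by
  have : {q : (Fin K → Fin K → ℝ) × (Fin K → ℝ) | IsPseudo (Matrix.of q.1)}
      = (⋂ k, {q | q.1 k k = 0}) ∩ (⋂ k, ⋂ l, {q | q.1 k l = q.1 l k})
        ∩ (⋂ k, ⋂ l, ⋂ m, {q | q.1 k m ≤ q.1 k l + q.1 l m}) := by
    ext q
    simp only [Set.mem_inter_iff, Set.mem_iInter, Set.mem_ofPred_eq]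
    exact ⟨fun h => ⟨⟨h.self, h.symm⟩, h.triangle⟩, fun h => ⟨h.1.1, h.1.2, h.2⟩⟩
  rw [this]
  refine (IsClosed.inter (isClosed_iInter fun k => ?_)
    (isClosed_iInter fun k => isClosed_iInter fun l => ?_)).inter
    (isClosed_iInter fun k => isClosed_iInter fun l => isClosed_iInter fun m => ?_)
  · exact isClosed_eq (by fun_prop) (by fun_prop)
  · exact isClosed_eq (by fun_prop) (by fun_prop)
  · exact isClosed_le (by fun_prop) (by fun_prop)

lemma aemeasurable_wLS {p : ℕ} {d : stdSimplex ℝ (Fin p) → stdSimplex ℝ (Fin p) → ℝ}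
    (hd : IsMetric d) {μ : Measure Ω} {Ahat : Ω → Fin K → stdSimplex ℝ (Fin p)}
    (hA : Measurable Ahat) (hdm : ∀ k l, AEMeasurable (fun ω => d (Ahat ω k) (Ahat ω l)) μ)
    {x y : Ω → Fin p → ℝ} (hx : AEMeasurable x μ) (hy : AEMeasurable y μ) :
    AEMeasurable (fun ω => wLS d (Ahat ω) (x ω) (y ω)) μ := by
  classical
  set T : Set ((Fin K → Fin K → ℝ) × (Fin K → ℝ)) := {q | IsPseudo (Matrix.of q.1)}
  have hH := (continuousOn_supportFun_dualPolytope (K := K)).measurable_piecewise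
    (g := fun _ => (0 : ℝ)) continuousOn_const isClosed_isPseudo.measurableSet
  have hB : ∀ j k, Measurable fun ω => colMatrix (Ahat ω) j k := fun j k =>
    (measurable_pi_apply j).comp (measurable_subtype_coe.comp ((measurable_pi_apply k).comp hA))
  have hL : ∀ {x : Ω → Fin p → ℝ}, AEMeasurable x μ → ∀ k,
      AEMeasurable (fun ω => (lsInv (colMatrix (Ahat ω)) *ᵥ x ω) k) μ := by
    intro x hx k
    simp only [mulVec_apply_eq_sum]
    exact Finset.aemeasurable_fun_sum _ fun j _ =>
      (measurable_lsInv_apply hB k j).aemeasurable.mul ((measurable_pi_apply j).comp_aemeasurable hx)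
  have hq : AEMeasurable (fun ω => ((fun k l => d (Ahat ω k) (Ahat ω l),
      lsInv (colMatrix (Ahat ω)) *ᵥ x ω - lsInv (colMatrix (Ahat ω)) *ᵥ y ω) :
      (Fin K → Fin K → ℝ) × (Fin K → ℝ))) μ := by
    refine AEMeasurable.prodMk ?_ ?_
    · exact aemeasurable_pi_lambda _ fun k => aemeasurable_pi_lambda _ fun l => hdm k l
    · exact aemeasurable_pi_lambda _ fun k => (hL hx k).sub (hL hy k)
  refine (hH.comp_aemeasurable hq).congr (Eventually.of_forall fun ω => ?_)
  exact Set.piecewise_eq_of_mem _ _ _ (show IsPseudo _ from hd.isPseudo_cost (Ahat ω))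

end

end TopicLS

namespace TopicLS

/-! ### Deterministic expansion of the estimator -/

lemma freq_mem_stdSimplex {p N : ℕ} (hN : 0 < N) {y : Fin p → ℕ} (hy : ∑ j, y j = N) :
    freq N y ∈ stdSimplex ℝ (Fin p) := by
  refine ⟨fun j => by unfold freq; positivity, ?_⟩
  have hN0 : (N : ℝ) ≠ 0 := by positivity
  simp only [freq, ← Finset.sum_div]
  rw [← Nat.cast_sum, hy, div_self hN0]

lemma ae_sum_eq_multinomial {p : ℕ} (N : ℕ) (r : Fin p → ℝ) :
    ∀ᵐ y ∂(multinomial N r), ∑ j, y j = N := by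
  have hm : Measurable fun (z : Fin N → Fin p) (j : Fin p) =>
      (Finset.univ.filter fun s => z s = j).card := measurable_of_countable _
  rw [multinomial, ae_map_iff hm.aemeasurable (Set.to_countable _).measurableSet]
  refine Eventually.of_forall fun z => ?_
  rw [← Finset.card_eq_sum_card_fiberwise (fun _ _ => Finset.mem_coe.2 (Finset.mem_univ _)),
    Finset.card_univ, Fintype.card_fin]

lemma norm_sub_le_of_mem_stdSimplex {K : ℕ} {a b : Fin K → ℝ} (ha : a ∈ stdSimplex ℝ (Fin K))
    (hb : b ∈ stdSimplex ℝ (Fin K)) : ‖a - b‖ ≤ 1 := by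
  refine (pi_norm_le_iff_of_nonneg zero_le_one).2 fun k => ?_
  have h1 : ∀ {a : Fin K → ℝ}, a ∈ stdSimplex ℝ (Fin K) → a k ≤ 1 := fun {a} ha => by
    rw [← ha.2]
    exact Finset.single_le_sum (fun l _ => ha.1 l) (Finset.mem_univ k)
  rw [Real.norm_eq_abs, Pi.sub_apply, abs_le]
  constructor <;> linarith [h1 ha, h1 hb, ha.1 k, hb.1 k]

lemma sum_abs_sub_le_of_mem_stdSimplex {p : ℕ} {x y : Fin p → ℝ} (hx : x ∈ stdSimplex ℝ (Fin p))
    (hy : y ∈ stdSimplex ℝ (Fin p)) : ∑ j, |(x - y) j| ≤ 2 := by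
  calc ∑ j, |(x - y) j| ≤ ∑ j, (x j + y j) := Finset.sum_le_sum fun j _ => by
        rw [Pi.sub_apply, abs_le]
        constructor <;> linarith [hx.1 j, hy.1 j]
    _ = 2 := by rw [Finset.sum_add_distrib, hx.2, hy.2]; norm_num

lemma isTopic_colMatrix {p K : ℕ} (A : Fin K → stdSimplex ℝ (Fin p))
    (hrow : ∀ m, ∃ k, 0 < colMatrix A m k) : IsTopic (colMatrix A) where
  nonneg j k := (A k).2.1 j
  col_sum k := (A k).2.2
  row_pos j := by
    obtain ⟨k, hk⟩ := hrow j
    exact hk.trans_le (Finset.single_le_sum (f := fun k => colMatrix A j k)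
      (fun l _ => (A l).2.1 j) (Finset.mem_univ k))

/-- Columns on the simplex sum to one, so a vector in the kernel of `A` has coordinate sum zero;
affine independence then forces it to vanish. -/
lemma isUnit_gram_colMatrix {p K : ℕ} {A : Fin K → stdSimplex ℝ (Fin p)}
    (hA : AffineIndependent ℝ fun k => (A k : Fin p → ℝ)) (hT : IsTopic (colMatrix A)) :
    IsUnit (gram (colMatrix A)).det := by
  refine hT.isUnit_gram fun v hv => ?_
  have hsum : ∑ k, v k = 0 := by
    rw [← one_dotProduct, ← hT.transpose_mulVec_one, ← Matrix.vecMul_transpose,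
      Matrix.transpose_transpose, ← Matrix.dotProduct_mulVec, hv, dotProduct_zero]
  have h := affineIndependent_iff.1 hA Finset.univ v hsum (by
    ext j
    have := congrFun hv j
    rw [mulVec_apply_eq_sum] at this
    simp only [Finset.sum_apply, Pi.smul_apply, smul_eq_mul, Pi.zero_apply] at this ⊢
    rw [← this]
    exact Finset.sum_congr rfl fun k _ => mul_comm _ _)
  ext k
  exact h k (Finset.mem_univ k)

/-- The estimator is close to the support function at the least squares estimator built from the
true mixture components. -/
lemma abs_wLS_sub_le {p K : ℕ} [NeZero K] {d : stdSimplex ℝ (Fin p) → stdSimplex ℝ (Fin p) → ℝ}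
    (hd : IsMetric d) {A Ahat : Fin K → stdSimplex ℝ (Fin p)} {τ : Equiv.Perm (Fin K)}
    (hA : IsTopic (colMatrix A)) (hu : IsUnit (gram (colMatrix A)).det)
    {ε δ b R ρ : ℝ} (hδ : ∀ k, d (Ahat (τ k)) (A k) ≤ δ)
    (hcol : ∀ k, ∑ j, |colMatrix Ahat j (τ k) - colMatrix A j k| ≤ ε)
    (hrow : ∀ j, ∑ k, |colMatrix Ahat j (τ k) - colMatrix A j k| ≤ ε * ∑ k, colMatrix A j k)
    (hε : 0 ≤ ε) (hε1 : ε < 1) (hb0 : 0 ≤ b)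
    (hb : ∀ x, ‖(gram (colMatrix A))⁻¹ *ᵥ x‖ ≤ b * ‖x‖) (hsmall : 6 * K * (b * ε) ≤ 1)
    {x y : Fin p → ℝ} (hx : x ∈ stdSimplex ℝ (Fin p)) (hy : y ∈ stdSimplex ℝ (Fin p))
    {v : Fin K → ℝ} (hv : ‖v‖ ≤ 1) (hR : ∀ k l, cost d A k l ≤ R)
    (hρ : ‖lsInv (colMatrix A) *ᵥ (x - y) - v‖ ≤ ρ) :
    |wLS d Ahat x y - supportFun (dualPolytope (cost d A)) (lsInv (colMatrix A) *ᵥ (x - y))|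
      ≤ 32 * K * (1 + ρ) * δ + K * R * (6 * K + 8) * (1 + ρ) * (b * ε) := by
  have hK : (1 : ℝ) ≤ K := by exact_mod_cast NeZero.one_le
  set B := (colMatrix Ahat).submatrix id τ with hBdef
  have hB : IsTopic B :=
    { nonneg := fun j k => (Ahat (τ k)).2.1 j
      col_sum := fun k => (Ahat (τ k)).2.2
      -- A relative row error below one cannot annihilate a row.
      row_pos := fun j => by
        have h1 : ∑ k, colMatrix A j k - ∑ k, B j k ≤ ε * ∑ k, colMatrix A j k := by
          rw [← Finset.sum_sub_distrib]
          refine (Finset.sum_le_sum fun k _ => ?_).trans (hrow j)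
          rw [abs_sub_comm]
          exact le_abs_self _
        have h2 := mul_pos (sub_pos.2 hε1) (hA.row_pos j)
        linarith }
  have hu' := isUnit_gram_of_close hA hB hcol hrow hε hu hb0 hb hsmall
  set z := x - y with hz
  have hzsum : ∑ j, z j = 0 := by simp [hz, hx.2, hy.2]
  have hz2 : ∑ j, |z j| ≤ 2 := sum_abs_sub_le_of_mem_stdSimplex hx hy
  have hρ0 : 0 ≤ ρ := (norm_nonneg _).trans hρ
  have hstab := norm_lsInv_sub_le hA hB hcol hrow hε hu hb0 hb hsmall hz2 hv
  have hc := hd.isPseudo_cost A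
  have hchat := hd.isPseudo_cost Ahat
  have hcτ : IsPseudo ((cost d Ahat).submatrix τ τ) :=
    ⟨fun _ => hchat.self _, fun _ _ => hchat.symm _ _, fun _ _ _ => hchat.triangle _ _ _⟩
  have hBsum : ∑ k, (lsInv B *ᵥ z) k = 0 := by rw [hB.sum_lsInv_mulVec hu', hzsum]
  have hrel := lsInv_submatrix_mulVec (colMatrix Ahat) τ z
  rw [← hBdef] at hrel
  have hhatsum : ∑ k, (lsInv (colMatrix Ahat) *ᵥ z) k = 0 := by
    rw [← Equiv.sum_comp τ, ← hBsum, hrel]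
    rfl
  have hw : wLS d Ahat x y
      = supportFun (dualPolytope ((cost d Ahat).submatrix τ τ)) (lsInv B *ᵥ z) := by
    rw [hrel, supportFun_dualPolytope_submatrix _ hchat τ hhatsum, wLS, hz, Matrix.mulVec_sub]
  have hcost : ∀ k l, |(cost d Ahat).submatrix τ τ k l - cost d A k l| ≤ 2 * δ := by
    intro k l
    simp only [Matrix.submatrix_apply, cost, Matrix.of_apply]
    have h1 := hd.triangle (Ahat (τ k)) (A k) (Ahat (τ l))
    have h2 := hd.triangle (A k) (A l) (Ahat (τ l))
    have h3 := hd.triangle (A k) (Ahat (τ k)) (A l)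
    have h4 := hd.triangle (Ahat (τ k)) (Ahat (τ l)) (A l)
    rw [hd.symm (A l) (Ahat (τ l))] at h2
    rw [hd.symm (A k) (Ahat (τ k))] at h3
    rw [abs_le]
    constructor <;> linarith [hδ k, hδ l]
  have h1 := hc.abs_supportFun_sub_le hcτ hcost hBsum
  have h2 := abs_supportFun_sub_le hc.nonempty (fun f hf => hc.norm_le_of_mem hR hf)
    (lsInv B *ᵥ z) (lsInv (colMatrix A) *ᵥ z)
  have hδ0 : 0 ≤ δ := by
    have := (abs_nonneg _).trans (hcost 0 0)
    linarith
  have hR0 : 0 ≤ R := (hc.nonneg 0 0).trans (hR 0 0)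
  have hbε : 0 ≤ b * ε := mul_nonneg hb0 hε
  have h3 : ‖lsInv B *ᵥ z - lsInv (colMatrix A) *ᵥ z‖ ≤ (6 * K + 8) * (b * ε) * (1 + ρ) :=
    hstab.trans (by gcongr)
  -- A crude consequence of `hsmall` and `K ≥ 1`. With `ρ` for the fluctuation and one for `v`, it
  -- yields the factor `16` in `h5`, which the cost error `2 δ` turns into `32`.
  have h4 : (6 * K + 8) * (b * ε) ≤ 14 := by
    have : b * ε ≤ K * (b * ε) := le_mul_of_one_le_left hbε hK
    linarith
  have h5 : ‖lsInv B *ᵥ z‖ ≤ 16 * (1 + ρ) := by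
    have e : lsInv B *ᵥ z = (lsInv B *ᵥ z - lsInv (colMatrix A) *ᵥ z)
        + (lsInv (colMatrix A) *ᵥ z - v) + v := by abel
    rw [e]
    refine (norm_add₃_le).trans ?_
    have : (6 * K + 8) * (b * ε) * (1 + ρ) ≤ 14 * (1 + ρ) := by gcongr
    linarith
  rw [hw]
  refine (abs_sub_le _ _ _).trans (add_le_add (h1.trans ?_) (h2.trans ?_))
  · calc K * (2 * δ) * ‖lsInv B *ᵥ z‖ ≤ K * (2 * δ) * (16 * (1 + ρ)) := by gcongr
      _ = _ := by ring
  · calc K * R * ‖lsInv B *ᵥ z - lsInv (colMatrix A) *ᵥ z‖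
        ≤ K * R * ((6 * K + 8) * (b * ε) * (1 + ρ)) := by gcongr
      _ = _ := by ring

/-! ### Limits of the covariance matrices -/

lemma dotProduct_mulVec_le_sum_mul_sq {K : ℕ} {S C : Matrix (Fin K) (Fin K) ℝ}
    (h : ∀ k l, |S k l| ≤ C k l) (x : Fin K → ℝ) :
    x ⬝ᵥ S *ᵥ x ≤ (∑ k, ∑ l, C k l) * ‖x‖ ^ 2 := by
  simp only [dotProduct, mulVec_apply_eq_sum, Finset.mul_sum, Finset.sum_mul]
  refine Finset.sum_le_sum fun k _ => Finset.sum_le_sum fun l _ => (le_abs_self _).trans ?_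
  rw [abs_mul, abs_mul]
  have h1 := norm_le_pi_norm x k
  have h2 := norm_le_pi_norm x l
  rw [Real.norm_eq_abs] at h1 h2
  calc |x k| * (|S k l| * |x l|) ≤ ‖x‖ * (C k l * ‖x‖) := by
        have := h k l
        have := (abs_nonneg _).trans this
        gcongr
    _ = _ := by ring

lemma tendsto_dotProduct_mulVec {K : ℕ} {S : ℕ → Matrix (Fin K) (Fin K) ℝ}
    {Q : Matrix (Fin K) (Fin K) ℝ} (h : Tendsto S atTop (𝓝 Q)) (x : Fin K → ℝ) :
    Tendsto (fun t => x ⬝ᵥ S t *ᵥ x) atTop (𝓝 (x ⬝ᵥ Q *ᵥ x)) := by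
  have : Continuous fun S : Matrix (Fin K) (Fin K) ℝ => x ⬝ᵥ S *ᵥ x := by fun_prop
  exact (this.tendsto Q).comp h

lemma transpose_sigmaLS {p K : ℕ} (B : Matrix (Fin p) (Fin K) ℝ) (r : Fin p → ℝ) :
    (sigmaLS B r)ᵀ = sigmaLS B r := by
  rw [sigmaLS, Matrix.transpose_mul, Matrix.transpose_mul, transpose_vLS, transpose_inv_gram,
    Matrix.mul_assoc]

lemma posSemidef_of_tendsto {K : ℕ} {S : ℕ → Matrix (Fin K) (Fin K) ℝ}
    {Q : Matrix (Fin K) (Fin K) ℝ} (h : Tendsto S atTop (𝓝 Q)) (hT : ∀ t, (S t)ᵀ = S t)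
    (h0 : ∀ t x, 0 ≤ x ⬝ᵥ S t *ᵥ x) : Q.PosSemidef := by
  refine Matrix.PosSemidef.of_dotProduct_mulVec_nonneg ?_ fun x => ?_
  · rw [Matrix.IsHermitian, Matrix.conjTranspose_eq_transpose_of_trivial]
    have h1 : Tendsto (fun t => (S t)ᵀ) atTop (𝓝 Qᵀ) :=
      ((continuous_id.matrix_transpose).tendsto Q).comp h
    simp only [hT] at h1
    exact tendsto_nhds_unique h1 h
  · rw [star_trivial]
    exact ge_of_tendsto' (tendsto_dotProduct_mulVec h x) fun t => h0 t x

end TopicLS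

/-! ### The limit theorem for the Wasserstein estimator -/

theorem mainTheorem12
    -- sizes: `K` topics; at stage `t`, `n t` documents of `N t` words over `p t` words
    (K : ℕ) [NeZero K] (hK : 2 ≤ K) (n N p : ℕ → ℕ)
    (hn : Tendsto n atTop atTop) (hN : Tendsto N atTop atTop)
    -- mixture components: affinely independent, no vanishing row
    (A : ∀ t, Fin K → stdSimplex ℝ (Fin (p t)))
    (hA : ∀ t, AffineIndependent ℝ fun k => (A t k : Fin (p t) → ℝ))
    (hrow : ∀ t m, ∃ k, 0 < TopicLS.colMatrix (A t) m k)
    -- mixture weights of all documents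
    (α : ∀ t, Fin (n t) → stdSimplex ℝ (Fin K))
    -- multinomial sampling of independent documents
    {Ω : ℕ → Type*} [∀ t, MeasurableSpace (Ω t)] (μ : ∀ t, Measure (Ω t))
    [∀ t, IsProbabilityMeasure (μ t)]
    (Y : ∀ t, Fin (n t) → Ω t → Fin (p t) → ℕ)
    (hY : ∀ t m, HasLaw (Y t m) (TopicLS.multinomial (N t)
      (TopicLS.colMatrix (A t) *ᵥ (α t m : Fin K → ℝ))) (μ t))
    (hindep : ∀ t, iIndepFun (Y t) (μ t))
    -- the metric on the simplex
    (d : ∀ t, stdSimplex ℝ (Fin (p t)) → stdSimplex ℝ (Fin (p t)) → ℝ)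
    (hd : ∀ t, TopicLS.IsMetric (d t))
    -- the pair of documents; the quantities that determine the limit do not vary with `t`
    (i j : ∀ t, Fin (n t)) (hij : ∀ t, i t ≠ j t)
    (c : Matrix (Fin K) (Fin K) ℝ) (hc : ∀ t, TopicLS.cost (d t) (A t) = c)
    (u : Fin K → ℝ) (hu : ∀ t, (α t (i t) : Fin K → ℝ) - (α t (j t) : Fin K → ℝ) = u)
    (w : ℝ) (hw : ∀ t, TopicLS.wasserstein c (α t (i t)) (α t (j t)) = w)
    -- the estimator of the mixture components, with values in the simplex
    (Ahat : ∀ t, Ω t → Fin K → stdSimplex ℝ (Fin (p t)))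
    (hAhat : ∀ t, Measurable (Ahat t))
    (hdmeas : ∀ t k l, AEMeasurable (fun ω => d t (Ahat t ω k) (Ahat t ω l)) (μ t))
    -- label permutation and error bounds
    (π : ∀ t, Ω t → Equiv.Perm (Fin K))
    (hπ : ∀ t (τ : Equiv.Perm (Fin K)), MeasurableSet {ω | π t ω = τ})
    (εA ε₁ ε₂ : ℕ → ℝ)
    (hεA_int : ∀ t, Integrable (fun ω => ⨆ k, d t (Ahat t ω (π t ω k)) (A t k)) (μ t))
    (hεA : ∀ t, ∫ ω, (⨆ k, d t (Ahat t ω (π t ω k)) (A t k)) ∂(μ t) ≤ εA t)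
    (hclose : Tendsto (fun t => μ t {ω | ¬ TopicLS.CloseUpTo (π t ω) (TopicLS.colMatrix (Ahat t ω))
      (TopicLS.colMatrix (A t)) (ε₁ t) (ε₂ t)}) atTop (𝓝 0))
    -- rate conditions
    (r : ∀ t, Fin (n t) → Fin (p t) → ℝ)
    (hr : ∀ t m, r t m = TopicLS.colMatrix (A t) *ᵥ (α t m : Fin K → ℝ))
    (lam : ℕ → ℝ)
    (hlam : ∀ t, lam t = min (TopicLS.eig (K - 1) (TopicLS.vLS (TopicLS.colMatrix (A t)) (r t (i t))))
      (TopicLS.eig (K - 1) (TopicLS.vLS (TopicLS.colMatrix (A t)) (r t (j t)))))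
    (hM : (fun t => (TopicLS.eig K (TopicLS.gram (TopicLS.colMatrix (A t))))⁻¹)
      =O[atTop] fun t => √(N t : ℝ))
    (hrateA : Tendsto (fun t => εA t * √(N t : ℝ)) atTop (𝓝 0))
    (hlam_pos : ∀ᶠ t in atTop, 0 < lam t)
    (hV : (fun t => (lam t)⁻¹) =o[atTop] fun t => (N t : ℝ))
    (hrate : Tendsto (fun t => (ε₁ t + ε₂ t) * √((N t : ℝ) / lam t)) atTop (𝓝 0))
    -- the limiting covariance matrix and the Gaussian vector
    (Q : Matrix (Fin K) (Fin K) ℝ)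
    (hQ : Tendsto (fun t => TopicLS.sigmaLS (TopicLS.colMatrix (A t)) (r t (i t))
      + TopicLS.sigmaLS (TopicLS.colMatrix (A t)) (r t (j t))) atTop (𝓝 Q))
    {Ω' : Type*} [MeasurableSpace Ω'] (μ' : Measure Ω') [IsProbabilityMeasure μ']
    (G : Ω' → EuclideanSpace ℝ (Fin K)) (hG : HasLaw G (multivariateGaussian 0 Q) μ') :
    TendstoInDistribution
      (fun t ω => √(N t : ℝ) *
        (TopicLS.wLS (d t) (Ahat t ω) (TopicLS.freq (N t) (Y t (i t) ω))
            (TopicLS.freq (N t) (Y t (j t) ω))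
          - TopicLS.wasserstein (TopicLS.cost (d t) (A t)) (α t (i t)) (α t (j t))))
      atTop
      (fun ω' => TopicLS.supportFun (TopicLS.dualFace c u w) (G ω').ofLp)
      μ μ' := by
  classical
  have hc0 : TopicLS.IsPseudo c := hc 0 ▸ (hd 0).isPseudo_cost (A 0)
  obtain ⟨R₀, hR₀, hcR⟩ := TopicLS.exists_entries_le c
  have hT : ∀ t, TopicLS.IsTopic (TopicLS.colMatrix (A t)) := fun t =>
    TopicLS.isTopic_colMatrix (A t) (hrow t)
  have hunit : ∀ t, IsUnit (TopicLS.gram (TopicLS.colMatrix (A t))).det := fun t =>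
    TopicLS.isUnit_gram_colMatrix (hA t) (hT t)
  have hrs : ∀ t m, r t m ∈ stdSimplex ℝ (Fin (p t)) := fun t m => by
    rw [hr]
    exact (hT t).mulVec_mem_stdSimplex (α t m).2
  have hu1 : ‖u‖ ≤ 1 := by
    rw [← hu 0]
    exact TopicLS.norm_sub_le_of_mem_stdSimplex (α 0 (i 0)).2 (α 0 (j 0)).2
  have hwas : ∀ t, TopicLS.wasserstein c (α t (i t)) (α t (j t))
      = TopicLS.supportFun (TopicLS.dualPolytope c) u := fun t =>
    (hc0.wasserstein_eq (α t (i t)).2 (α t (j t)).2).trans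
      (congrArg (TopicLS.supportFun (TopicLS.dualPolytope c)) (hu t))
  have hw' : w = TopicLS.supportFun (TopicLS.dualPolytope c) u := by rw [← hw 0, hwas 0]
  set L : ∀ t, Matrix (Fin K) (Fin (p t)) ℝ := fun t => TopicLS.lsInv (TopicLS.colMatrix (A t))
    with hL
  have hLu : ∀ t, L t *ᵥ (r t (i t) - r t (j t)) = u := fun t => by
    rw [hr, hr, ← Matrix.mulVec_sub, hu t, hL]
    exact TopicLS.lsInv_mulVec_mulVec (hunit t) u
  set S : ℕ → Matrix (Fin K) (Fin K) ℝ := fun t =>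
    TopicLS.sigmaLS (TopicLS.colMatrix (A t)) (r t (i t))
      + TopicLS.sigmaLS (TopicLS.colMatrix (A t)) (r t (j t)) with hS
  have hSq : ∀ t x, x ⬝ᵥ S t *ᵥ x = TopicLS.quadVar (r t (i t)) ((L t)ᵀ *ᵥ x)
      + TopicLS.quadVar (r t (j t)) ((L t)ᵀ *ᵥ x) := fun t x => by
    rw [hS, Matrix.add_mulVec, dotProduct_add, TopicLS.dotProduct_sigmaLS_eq_quadVar,
      TopicLS.dotProduct_sigmaLS_eq_quadVar]
  have hqn : ∀ t m x, 0 ≤ TopicLS.quadVar (r t m) ((L t)ᵀ *ᵥ x) := fun t m x =>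
    TopicLS.quadVar_nonneg (hrs t m) _
  have hQpsd : Q.PosSemidef := TopicLS.posSemidef_of_tendsto hQ
    (fun t => by rw [Matrix.transpose_add, TopicLS.transpose_sigmaLS, TopicLS.transpose_sigmaLS])
    fun t x => by
      rw [hSq]
      exact add_nonneg (hqn _ _ _) (hqn _ _ _)
  -- bounds on the inverse Gram matrix
  set C : ℝ := ∑ k, ∑ l, (|Q k l| + 1) with hC
  have hC0 : 0 ≤ C := by positivity
  have hSC : ∀ᶠ t in atTop, ∀ k l, |S t k l| ≤ |Q k l| + 1 := by
    refine eventually_all.2 fun k => eventually_all.2 fun l => ?_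
    have h1 : Tendsto (fun t => |S t k l|) atTop (𝓝 |Q k l|) :=
      (((continuous_id.matrix_elem k l).tendsto Q).comp hQ).abs
    exact h1.eventually (eventually_le_nhds (lt_add_one _))
  -- The bound on `M⁻¹` in sup norm: for large `t`, `C` dominates the quadratic form of each
  -- covariance matrix, as the other summand is nonnegative.
  set b : ℕ → ℝ := fun t => √((C + K) / lam t) with hb
  have hN0 : ∀ᶠ t in atTop, 0 < N t := hN.eventually_gt_atTop 0
  have hlam1 : ∀ᶠ t in atTop, lam t ≤ 1 := by
    filter_upwards [hlam_pos] with t h1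
    have h2 : lam t ≤ _ := (hlam t).trans_le (min_le_left _ _)
    exact h2.trans ((hT t).eig_vLS_le_one hK (hrs t _) (h1.trans_le h2))
  have hbM : ∀ᶠ t in atTop, ∀ x,
      ‖(TopicLS.gram (TopicLS.colMatrix (A t)))⁻¹ *ᵥ x‖ ≤ b t * ‖x‖ := by
    filter_upwards [hlam_pos, hSC] with t h1 h2
    refine (hT t).norm_inv_gram_mulVec_le hK (hunit t) (hrs t (i t)) h1
      ((hlam t).trans_le (min_le_left _ _)) fun x => ?_
    have h3 := TopicLS.dotProduct_mulVec_le_sum_mul_sq h2 x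
    rw [hSq] at h3
    rw [TopicLS.dotProduct_sigmaLS_eq_quadVar]
    linarith [hqn t (j t) x]
  -- The Lindeberg-type condition of the central limit theorem, equivalent up to constants to `λ⁻¹ =
  -- o(N)`.
  have hbN : Tendsto (fun t => b t / √(N t : ℝ)) atTop (𝓝 0) := by
    have h1 := (hV.tendsto_div_nhds_zero).const_mul (C + K)
    rw [mul_zero] at h1
    have h2 := (Real.continuous_sqrt.tendsto 0).comp h1
    rw [Real.sqrt_zero] at h2
    refine h2.congr' ?_
    filter_upwards [hlam_pos] with t h3
    simp only [hb, Function.comp_apply]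
    rw [← Real.sqrt_div (by positivity)]
    congr 1
    ring
  -- the central limit theorem for the infeasible estimator
  have hclt := TopicLS.tendstoInDistribution_multinomial (μ := μ) hN (fun t => hrs t (i t))
    (fun t => hrs t (j t)) (Y := fun t => Y t (i t)) (Y' := fun t => Y t (j t))
    (fun t => by rw [hr]; exact hY t (i t)) (fun t => by rw [hr]; exact hY t (j t))
    (fun t => (hindep t).indepFun (hij t)) L hbN
    (hbM.mono fun t ht v m => (hT t).abs_transpose_lsInv_le ht v m) hQpsd
    (fun v => (TopicLS.tendsto_dotProduct_mulVec hQ v).congr fun t => hSq t v) hG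
  -- the limiting functional
  have hface : TopicLS.dualFace c u w = TopicLS.dualPolytope c
      ∩ {f | f ⬝ᵥ u = TopicLS.supportFun (TopicLS.dualPolytope c) u} := by
    rw [TopicLS.dualFace, hw']
  have hfne : (TopicLS.dualFace c u w).Nonempty := by
    obtain ⟨f, hf, hfu⟩ := TopicLS.exists_supportFun_eq hc0.nonempty hc0.isCompact u
    rw [hface]
    exact ⟨f, hf, hfu⟩
  have hgcont : Continuous fun z : EuclideanSpace ℝ (Fin K) =>
      TopicLS.supportFun (TopicLS.dualFace c u w) z.ofLp :=
    (TopicLS.continuous_supportFun hfne fun f hf => hc0.norm_le_of_mem hcR hf.1).comp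
      (PiLp.continuous_ofLp 2 _)
  have hfreq : ∀ t m, AEMeasurable (fun ω => TopicLS.freq (N t) (Y t m ω)) (μ t) := fun t m =>
    (measurable_of_countable (TopicLS.freq (N t))).comp_aemeasurable (hY t m).aemeasurable
  refine TopicLS.tendstoInDistribution_of_close hclt hgcont (fun t =>
    ((TopicLS.aemeasurable_wLS (hd t) (hAhat t) (hdmeas t) (hfreq t _) (hfreq t _)).sub
      aemeasurable_const).const_mul _) fun R η hη => ?_
  set ρ : ℝ := |R| with hρ
  set δ : ∀ t, Ω t → ℝ := fun t ω => ⨆ k, d t (Ahat t ω (π t ω k)) (A t k) with hδ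
  have hdn : ∀ t x y, 0 ≤ d t x y := fun t x y => by
    have := (hd t).triangle x y x
    rw [(hd t).self, (hd t).symm y x] at this
    linarith
  have hδn : ∀ t ω, 0 ≤ δ t ω := fun t ω => Real.iSup_nonneg fun k => hdn _ _ _
  -- The tolerance `η` is shared equally by the cost error, the least squares error and the slope
  -- error. `κ` is the largest value of `√N δ` admitted for the first share; Markov's inequality
  -- makes larger values improbable.
  set κ : ℝ := η / (3 * (32 * K * (1 + ρ) + 1)) with hκ
  have hκ0 : 0 < κ := by positivity
  have hmarkov : Tendsto (fun t => μ t {ω | κ ≤ √(N t : ℝ) * δ t ω}) atTop (𝓝 0) := by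
    have h1 : Tendsto (fun t => (μ t).real {ω | κ ≤ √(N t : ℝ) * δ t ω}) atTop (𝓝 0) := by
      have h2 : Tendsto (fun t => κ⁻¹ * (εA t * √(N t : ℝ))) atTop (𝓝 0) := by
        simpa using hrateA.const_mul κ⁻¹
      refine squeeze_zero (fun t => measureReal_nonneg) (fun t => ?_) h2
      have h3 := mul_meas_ge_le_integral_of_nonneg (μ := μ t) (f := fun ω => √(N t : ℝ) * δ t ω)
        (Eventually.of_forall fun ω => mul_nonneg (Real.sqrt_nonneg _) (hδn t ω))
        ((hεA_int t).const_mul _) κ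
      rw [integral_const_mul] at h3
      rw [le_inv_mul_iff₀ hκ0]
      refine h3.trans ?_
      rw [mul_comm (εA t)]
      exact mul_le_mul_of_nonneg_left (hεA t) (Real.sqrt_nonneg _)
    have h2 := ENNReal.tendsto_ofReal h1
    rw [ENNReal.ofReal_zero] at h2
    exact h2.congr fun t => ofReal_measureReal
  have hslope : ∀ᶠ t in atTop, ∀ z : Fin K → ℝ, ‖z‖ ≤ ρ →
      |√(N t : ℝ) * (TopicLS.supportFun (TopicLS.dualPolytope c) (u + (√(N t : ℝ))⁻¹ • z)
        - TopicLS.supportFun (TopicLS.dualPolytope c) u)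
        - TopicLS.supportFun (TopicLS.dualFace c u w) z| ≤ η / 3 := by
    rw [hface]
    exact (Real.tendsto_sqrt_atTop.comp (tendsto_natCast_atTop_atTop.comp hN)).eventually
      (TopicLS.eventually_supportFun_slope hc0.nonempty hc0.isCompact u ρ (by positivity))
  set a : ℕ → ℝ := fun t => (ε₁ t + ε₂ t) * √((N t : ℝ) / lam t) with ha
  have hba : ∀ᶠ t in atTop, √(N t : ℝ) * (b t * (ε₁ t + ε₂ t)) = √(C + K) * a t := by
    filter_upwards [hlam_pos] with t h1
    simp only [hb, ha]
    rw [Real.sqrt_div (by positivity), Real.sqrt_div (by positivity)]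
    ring
  have ha1 : ∀ᶠ t in atTop, a t < 1 := hrate.eventually_lt_const one_pos
  have ha2 : ∀ᶠ t in atTop, 6 * K * (√(C + K) * a t) ≤ 1 := by
    have := (hrate.const_mul √(C + K)).const_mul (6 * K : ℝ)
    rw [mul_zero, mul_zero] at this
    exact this.eventually (eventually_le_nhds one_pos)
  have ha3 : ∀ᶠ t in atTop, K * R₀ * (6 * K + 8) * (1 + ρ) * (√(C + K) * a t) ≤ η / 3 := by
    have := (hrate.const_mul √(C + K)).const_mul (K * R₀ * (6 * K + 8) * (1 + ρ) : ℝ)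
    rw [mul_zero, mul_zero] at this
    exact this.eventually (eventually_le_nhds (by positivity))
  -- Observed frequencies lie in the simplex only if the counts sum to `N`, which holds off a null
  -- set.
  have hzero : ∀ᶠ t in atTop, ∀ m, μ t {ω | ¬ ∑ l, Y t m ω l = N t} = 0 :=
    Eventually.of_forall fun t m =>
      ((hY t m).ae_iff (p := fun y => ∑ l, y l = N t) (measurable_of_countable _)).2
        (TopicLS.ae_sum_eq_multinomial _ _)
  refine tendsto_of_tendsto_of_tendsto_of_le_of_le' tendsto_const_nhds
    (by simpa using hclose.add hmarkov) (Eventually.of_forall fun _ => zero_le) ?_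
  filter_upwards [hN0, hlam_pos, hlam1, hbM, hslope, hba, ha1, ha2, ha3, hzero]
    with t hNt hlt hl1 hbt hst hbat ha1t ha2t ha3t hzt
  have hN1 : (1 : ℝ) ≤ N t := by exact_mod_cast hNt
  have hsN : 1 ≤ √(N t : ℝ) := Real.one_le_sqrt.2 hN1
  have hsN0 : 0 < √(N t : ℝ) := zero_lt_one.trans_le hsN
  set bad : Set (Ω t) := {ω | ¬ ∑ l, Y t (i t) ω l = N t} ∪ {ω | ¬ ∑ l, Y t (j t) ω l = N t}
    with hbad
  have hbad0 : μ t bad = 0 := measure_union_null (hzt _) (hzt _)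
  refine (measure_mono (t := ({ω | ¬ TopicLS.CloseUpTo (π t ω) (TopicLS.colMatrix (Ahat t ω))
      (TopicLS.colMatrix (A t)) (ε₁ t) (ε₂ t)} ∪ {ω | κ ≤ √(N t : ℝ) * δ t ω}) ∪ bad)
    fun ω hω => ?_).trans
    ((measure_union_le _ _).trans (by
      rw [hbad0, add_zero]
      exact measure_union_le _ _))
  by_contra hcon
  simp only [Set.mem_union, not_or, Set.mem_ofPred_eq, not_not, not_le, hbad] at hcon
  obtain ⟨⟨hcl, hκω⟩, hYi, hYj⟩ := hcon
  obtain ⟨hZR, hlt3⟩ := hω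
  refine absurd hlt3 (not_lt.2 ?_)
  set x := TopicLS.freq (N t) (Y t (i t) ω)
  set y := TopicLS.freq (N t) (Y t (j t) ω)
  have hx : x ∈ stdSimplex ℝ (Fin (p t)) := TopicLS.freq_mem_stdSimplex hNt hYi
  have hy : y ∈ stdSimplex ℝ (Fin (p t)) := TopicLS.freq_mem_stdSimplex hNt hYj
  -- A row must exist for the sign of `ε₂ t` to be read off from the row bound.
  have hpne : Nonempty (Fin (p t)) := by
    by_contra hne
    rw [not_nonempty_iff] at hne
    have := hx.2
    simp at this
  have hε₁0 : 0 ≤ ε₁ t := (Finset.sum_nonneg fun _ _ => abs_nonneg _).trans (hcl.1 0)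
  have hε₂0 : 0 ≤ ε₂ t := (div_nonneg (Finset.sum_nonneg fun _ _ => abs_nonneg _)
    (Finset.sum_nonneg fun _ _ => abs_nonneg _)).trans (hcl.2 hpne.some)
  have hε0 : 0 ≤ ε₁ t + ε₂ t := add_nonneg hε₁0 hε₂0
  -- `N / λ ≥ 1` because `λ ≤ 1 ≤ N`, so the rate condition also controls the errors without their
  -- factor.
  have hε1 : ε₁ t + ε₂ t < 1 := by
    refine lt_of_le_of_lt ?_ ha1t
    refine le_mul_of_one_le_right hε0 (Real.one_le_sqrt.2 ?_)
    rw [one_le_div hlt]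
    linarith
  have hb0 : 0 ≤ b t := Real.sqrt_nonneg _
  have hbε : 0 ≤ b t * (ε₁ t + ε₂ t) := mul_nonneg hb0 hε0
  have hsmall : 6 * K * (b t * (ε₁ t + ε₂ t)) ≤ 1 := by
    refine le_trans ?_ ha2t
    rw [← hbat]
    have := le_mul_of_one_le_left hbε hsN
    gcongr
  have hrow' : ∀ m, ∑ k, |TopicLS.colMatrix (Ahat t ω) m (π t ω k) - TopicLS.colMatrix (A t) m k|
      ≤ (ε₁ t + ε₂ t) * ∑ k, TopicLS.colMatrix (A t) m k := fun m => by
    have h1 := hcl.2 m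
    have e : ∑ k, |TopicLS.colMatrix (A t) m k| = ∑ k, TopicLS.colMatrix (A t) m k :=
      Finset.sum_congr rfl fun k _ => abs_of_nonneg ((hT t).nonneg m k)
    rw [e, div_le_iff₀ ((hT t).row_pos m)] at h1
    refine h1.trans (mul_le_mul_of_nonneg_right ?_ ((hT t).row_pos m).le)
    linarith
  have hZ : ‖√(N t : ℝ) • (L t *ᵥ (x - y) - u)‖ ≤ ρ := by
    have h1 : ‖(WithLp.toLp 2 (√(N t : ℝ) • (L t *ᵥ (x - y) - L t *ᵥ (r t (i t) - r t (j t)))) :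
      EuclideanSpace ℝ (Fin K))‖ ≤ R := hZR
    rw [hLu] at h1
    refine (pi_norm_le_iff_of_nonneg (abs_nonneg R)).2 fun k => ?_
    exact (PiLp.norm_apply_le (WithLp.toLp 2 (√(N t : ℝ) • (L t *ᵥ (x - y) - u)) :
      EuclideanSpace ℝ (Fin K)) k).trans (h1.trans (le_abs_self R))
  have hZ' : ‖L t *ᵥ (x - y) - u‖ ≤ ρ := by
    refine le_trans ?_ hZ
    rw [norm_smul, Real.norm_of_nonneg hsN0.le]
    exact le_mul_of_one_le_left (norm_nonneg _) hsN
  have key := TopicLS.abs_wLS_sub_le (hd t) (Ahat := Ahat t ω) (τ := π t ω) (hT t) (hunit t)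
    (δ := δ t ω) (fun k => le_ciSup (f := fun k => d t (Ahat t ω (π t ω k)) (A t k))
      (Set.finite_range _).bddAbove k)
    (fun k => (hcl.1 k).trans (le_add_of_nonneg_right hε₂0)) hrow' hε0 hε1 hb0 hbt hsmall hx hy
    hu1 (R := R₀) (fun k l => by rw [hc]; exact hcR k l) hZ'
  rw [hc t] at key ⊢
  have hst' := hst _ hZ
  rw [smul_smul, inv_mul_cancel₀ hsN0.ne', one_smul, add_sub_cancel] at hst'
  rw [hwas t, hLu]
  set h := TopicLS.supportFun (TopicLS.dualPolytope c) with hh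
  set W := TopicLS.wLS (d t) (Ahat t ω) x y
  have hkey : |√(N t : ℝ) * (W - h (L t *ᵥ (x - y)))| ≤ 2 * (η / 3) := by
    rw [abs_mul, abs_of_pos hsN0]
    refine (mul_le_mul_of_nonneg_left key hsN0.le).trans ?_
    have h1 : 32 * K * (1 + ρ) * (√(N t : ℝ) * δ t ω) ≤ η / 3 := by
      have hρ0 : 0 ≤ ρ := abs_nonneg R
      calc 32 * K * (1 + ρ) * (√(N t : ℝ) * δ t ω) ≤ (32 * K * (1 + ρ) + 1) * κ := by
            refine mul_le_mul (by linarith) hκω.le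
              (mul_nonneg hsN0.le (hδn t ω)) (by positivity)
        _ = η / 3 := by
            rw [hκ]
            field_simp
    have h2 := ha3t
    rw [← hbat] at h2
    linarith
  -- The cost and least squares errors go into the first term, at most `2 η / 3`; the second is the
  -- slope error at the bounded direction, at most `η / 3`.
  have e : √(N t : ℝ) * (W - h u) - TopicLS.supportFun (TopicLS.dualFace c u w)
      (√(N t : ℝ) • (L t *ᵥ (x - y) - u))
      = √(N t : ℝ) * (W - h (L t *ᵥ (x - y))) + (√(N t : ℝ) * (h (L t *ᵥ (x - y)) - h u)
        - TopicLS.supportFun (TopicLS.dualFace c u w) (√(N t : ℝ) • (L t *ᵥ (x - y) - u))) := by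
    ring
  rw [e]
  refine (abs_add_le _ _).trans ?_
  linarith
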